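/- **Setting.** Let $G,\tilde G$ be second countable locally compact (Hausdorff) groups with units $e,\varepsilon$ and left Haar measures, $\mathcal A$ a separable $C^*$-algebra, $\mathcal{UM}(\mathcal A)$ the unitary group of its multiplier algebra $\mathcal M(\mathcal A)$, $\mathrm{ad}_m(A)=mAm^*$; automorphisms are extended canonically to multipliers. A *twisted action* $(a,\alpha)$ of $G$ on $\mathcal A$ consists of maps $a:G\to\mathrm{Aut}(\mathcal A)$, $\alpha:G\times G\to\mathcal{UM}(\mathcal A)$ with $a_e=\mathrm{id}$, $a_xa_y=\mathrm{ad}_{\alpha(x,y)}a_{xy}$, $\alpha(x,e)=1=\alpha(e,x)$, $\alpha(x,y)\alpha(xy,z)=a_x[\alpha(y,z)]\alpha(x,yz)$. It is measurable (continuous) if $a$ is strongly and $\alpha$ strictly measurable with respect to Haar measure (continuous). A measurable (continuous) *covariant structure* $\{(\mathcal A,\kappa),(a,\alpha),(\tilde a,\tilde\alpha)\}$ consists of measurable (continuous) twisted actions $(a,\alpha)$ of $G$ and $(\tilde a,\tilde\alpha)$ of $\tilde G$ on the separable $C^*$-algebra $\mathcal A$ and a strictly continuous $\kappa:G\times\tilde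 G\to\mathcal{UM}(\mathcal A)$ with $\kappa(e,\xi)=1=\kappa(x,\varepsilon)$ such that for all $x,y\in G$, $\xi,\eta\in\tilde G$ $$a_x\tilde a_\xi=\mathrm{ad}_{\kappa(x,\xi)}\tilde a_\xi a_x,\qquad a_x[\tilde\alpha(\xi,\eta)]=\kappa(x,\xi)\,\tilde a_\xi[\kappa(x,\eta)]\,\tilde\alpha(\xi,\eta)\,\kappa(x,\xi\eta)^*,$$ $$\tilde a_\xi[\alpha(x,y)]=\kappa(x,\xi)^*\,a_x[\kappa(y,\xi)^*]\,\alpha(x,y)\,\kappa(xy,\xi).$$ It is *$\tilde G$-particular* if there is a strictly measurable (continuous) $\tilde\rho:\tilde G\to\mathcal{UM}(\mathcal A)$ with $\tilde\rho_\varepsilon=1$, $\tilde a_\xi=\mathrm{ad}_{\tilde\rho_\xi}$, $\tilde\alpha(\xi,\eta)=\tilde\rho_\xi\tilde\rho_\eta\tilde\rho_{\xi\eta}^*$ and $a_x(\tilde\rho_\xi)=\kappa(x,\xi)\tilde\rho_\xi$. The twisted crossed product $\mathcal A\rtimes_{\tilde a}^{\tilde\alpha}\tilde G$ is the enveloping $C^*$-algebra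 of the Banach $^*$-algebra $L^1(\tilde G;\mathcal A)$ with the laws $$(f\diamond g)(\zeta)=\int_{\tilde G}f(\eta)\,\tilde a_\eta[g(\eta^{-1}\zeta)]\,\tilde\alpha(\eta,\eta^{-1}\zeta)\,d\eta,\qquad f^\diamond(\zeta)=\Delta(\zeta)^{-1}\tilde\alpha(\zeta,\zeta^{-1})^*\,\tilde a_\zeta[f(\zeta^{-1})^*],$$ where $\Delta$ is the modular function of $\tilde G$. For $\xi\in\tilde G$ and $m\in\mathcal{UM}(\mathcal A)$, $\delta_\xi\otimes m$ denotes the unitary multiplier of $\mathcal A\rtimes_{\tilde a}^{\tilde\alpha}\tilde G$ given on $f\in L^1(\tilde G;\mathcal A)$ by $$[(\delta_\xi\otimes m)\diamond f](\zeta)=m\,\tilde a_\xi[f(\xi^{-1}\zeta)]\,\tilde\alpha(\xi,\xi^{-1}\zeta),$$ $$[f\diamond(\delta_\xi\otimes m)](\zeta)=\Delta(\xi)^{-1}f(\zeta\xi^{-1})\,\tilde a_{\zeta\xi^{-1}}(m)\,\tilde\alpha(\zeta\xi^{-1},\xi).$$ **Theorem.** If $\{(\mathcal A,\kappa),(a,\alpha),(\tilde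 a,\tilde\alpha)\}$ is a measurable (resp. continuous) covariant structure, then the formulas $$\tilde k(x,\xi)=\delta_\varepsilon\otimes\kappa(x,\xi),\qquad [c_x(f)](\zeta)=a_x[f(\zeta)]\,\kappa(x,\zeta)\quad(f\in L^1(\tilde G;\mathcal A)),\qquad \gamma(x,y)=\delta_\varepsilon\otimes\alpha(x,y),$$ $$\tilde c_\xi=\mathrm{ad}_{\delta_\xi\otimes1},\qquad \tilde\gamma(\xi,\eta)=(\delta_\xi\otimes1)\diamond(\delta_\eta\otimes1)\diamond(\delta_{\xi\eta}\otimes1)^{\diamond}=\delta_\varepsilon\otimes\tilde\alpha(\xi,\eta)$$ define a measurable (resp. continuous) $\tilde G$-particular covariant structure $\{(\mathcal A\rtimes_{\tilde a}^{\tilde\alpha}\tilde G,\tilde k),(c,\gamma),(\tilde c,\tilde\gamma)\}$, with $\tilde\rho_\xi=\delta_\xi\otimes1$. In particular these multipliers exist and each $c_x$ extends to an automorphism of $\mathcal A\rtimes_{\tilde a}^{\tilde\alpha}\tilde G$. -/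

import Mathlib

open MeasureTheory Topology
open scoped ENNReal MultiplierAlgebra

universe u v w

noncomputable section

namespace CovStr

/-! ### Multipliers

`𝓜(ℂ, A)` is the multiplier algebra. For `m : 𝓜(ℂ, A)` and `b : A`, the product `m b` is `m.fst b`
and the product `b m` is `m.snd b`. -/

section Multipliers

variable {A : Type u} [NonUnitalCStarAlgebra A]

/-- The inner automorphism `ad_m (b) = m b m⋆` attached to a unitary multiplier `m`. -/
def ad (m : unitary 𝓜(ℂ, A)) (b : A) : A :=
  (m : 𝓜(ℂ, A)).fst ((star (m : 𝓜(ℂ, A))).snd b)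

/-- A `⋆`-automorphism of a `C⋆`-algebra as a continuous linear map. -/
def autCLM (φ : A ≃⋆ₐ[ℂ] A) : A →L[ℂ] A where
  toFun := φ
  map_add' := map_add φ
  map_smul' := fun c b => map_smul φ c b
  cont := (NonUnitalStarAlgHom.isometry φ φ.injective).continuous

/-- The canonical extension of an automorphism `φ` of `A` to the multiplier algebra: it is
determined by `φ(m) φ(b) = φ(m b)` and `φ(b) φ(m) = φ(b m)`. -/
def extendMul (φ : A ≃⋆ₐ[ℂ] A) (m : 𝓜(ℂ, A)) : 𝓜(ℂ, A) where
  fst := (autCLM φ).comp (m.fst.comp (autCLM φ.symm))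
  snd := (autCLM φ).comp (m.snd.comp (autCLM φ.symm))
  central := fun b c => by
    have h := congrArg φ (m.central (φ.symm b) (φ.symm c))
    simpa [autCLM, map_mul] using h

/-- Strict continuity of a multiplier-valued map. -/
def StrictContinuous {X : Type v} [TopologicalSpace X] (m : X → 𝓜(ℂ, A)) : Prop :=
  ∀ b : A, Continuous (fun t => (m t).fst b) ∧ Continuous (fun t => (m t).snd b)

/-- Strict measurability, with respect to a measure, of a multiplier-valued map. -/
def StrictMeasurable {X : Type v} [MeasurableSpace X] (m : X → 𝓜(ℂ, A)) (μ : Measure X) : Prop :=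
  ∀ b : A, AEStronglyMeasurable (fun t => (m t).fst b) μ ∧
    AEStronglyMeasurable (fun t => (m t).snd b) μ

end Multipliers

/-! ### Twisted actions -/

/-- A twisted action of the group `G` on the `C⋆`-algebra `A`. -/
structure TwistedAction (G : Type v) (A : Type u) [Group G] [NonUnitalCStarAlgebra A] where
  act : G → (A ≃⋆ₐ[ℂ] A)
  cocycle : G → G → unitary 𝓜(ℂ, A)
  act_one : ∀ b, act 1 b = b
  act_act : ∀ x y b, act x (act y b) = ad (cocycle x y) (act (x * y) b)
  cocycle_one_right : ∀ x, cocycle x 1 = 1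
  cocycle_one_left : ∀ x, cocycle 1 x = 1
  cocycle_mul : ∀ x y z, (cocycle x y : 𝓜(ℂ, A)) * cocycle (x * y) z =
    extendMul (act x) (cocycle y z) * cocycle x (y * z)

namespace TwistedAction

variable {G : Type v} {A : Type u} [Group G] [NonUnitalCStarAlgebra A]

/-- The action is strongly measurable and the cocycle is strictly measurable with respect to the
(Haar) measure `μ` of the group. -/
def IsMeasurable [MeasurableSpace G] (a : TwistedAction G A) (μ : Measure G) : Prop :=
  (∀ b : A, AEStronglyMeasurable (fun x => a.act x b) μ) ∧
    StrictMeasurable (fun p : G × G => (a.cocycle p.1 p.2 : 𝓜(ℂ, A))) (μ.prod μ)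

/-- The action is strongly continuous and the cocycle is strictly continuous. -/
def IsContinuous [TopologicalSpace G] (a : TwistedAction G A) : Prop :=
  (∀ b : A, Continuous (fun x => a.act x b)) ∧
    StrictContinuous (fun p : G × G => (a.cocycle p.1 p.2 : 𝓜(ℂ, A)))

end TwistedAction

/-! ### Covariant structures -/

/-- A (measurable) covariant structure `{(A, κ), (a, α), (ã, α̃)}` for the groups `G` and `Γ`, with
Haar measures `μ` and `ν`; `base = (a, α)` and `tilde = (ã, α̃)`. -/
structure CovariantStructure (G : Type v) (Γ : Type w) (A : Type u)
    [Group G] [TopologicalSpace G] [MeasurableSpace G]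
    [Group Γ] [TopologicalSpace Γ] [MeasurableSpace Γ]
    [NonUnitalCStarAlgebra A] (μ : Measure G) (ν : Measure Γ) where
  separable : TopologicalSpace.SeparableSpace A
  base : TwistedAction G A
  tilde : TwistedAction Γ A
  base_measurable : base.IsMeasurable μ
  tilde_measurable : tilde.IsMeasurable ν
  κ : G → Γ → unitary 𝓜(ℂ, A)
  κ_continuous : StrictContinuous (fun p : G × Γ => (κ p.1 p.2 : 𝓜(ℂ, A)))
  κ_one_left : ∀ ξ, κ 1 ξ = 1
  κ_one_right : ∀ x, κ x 1 = 1
  /-- `a_x ∘ ã_ξ = ad_{κ(x,ξ)} ∘ ã_ξ ∘ a_x` -/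
  commutation : ∀ x ξ b,
    base.act x (tilde.act ξ b) = ad (κ x ξ) (tilde.act ξ (base.act x b))
  /-- `a_x[α̃(ξ,η)] = κ(x,ξ) ã_ξ[κ(x,η)] α̃(ξ,η) κ(x,ξη)⋆` -/
  act_tilde_cocycle : ∀ x ξ η,
    extendMul (base.act x) (tilde.cocycle ξ η) =
      (κ x ξ : 𝓜(ℂ, A)) * extendMul (tilde.act ξ) (κ x η) * tilde.cocycle ξ η *
        star (κ x (ξ * η) : 𝓜(ℂ, A))
  /-- `ã_ξ[α(x,y)] = κ(x,ξ)⋆ a_x[κ(y,ξ)⋆] α(x,y) κ(xy,ξ)` -/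
  tilde_act_cocycle : ∀ x y ξ,
    extendMul (tilde.act ξ) (base.cocycle x y) =
      star (κ x ξ : 𝓜(ℂ, A)) * extendMul (base.act x) (star (κ y ξ : 𝓜(ℂ, A))) *
        base.cocycle x y * κ (x * y) ξ

namespace CovariantStructure

variable {G : Type v} {Γ : Type w} {A : Type u}
  [Group G] [TopologicalSpace G] [MeasurableSpace G]
  [Group Γ] [TopologicalSpace Γ] [MeasurableSpace Γ]
  [NonUnitalCStarAlgebra A] {μ : Measure G} {ν : Measure Γ}

/-- A covariant structure is continuous if both its twisted actions are. -/
def IsContinuous (S : CovariantStructure G Γ A μ ν) : Prop :=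
  S.base.IsContinuous ∧ S.tilde.IsContinuous

/-- The covariant structure is particular with respect to its second group: its second twisted
action is `ã_ξ = ad_{ρ_ξ}`, `α̃(ξ,η) = ρ_ξ ρ_η ρ_{ξη}⋆` for the `1`-cochain `ρ`, and the covariance
condition `a_x(ρ_ξ) = κ(x,ξ) ρ_ξ` holds. -/
structure IsTildeParticular (S : CovariantStructure G Γ A μ ν) (ρ : Γ → unitary 𝓜(ℂ, A)) :
    Prop where
  cochain_one : ρ 1 = 1
  cochain_measurable : StrictMeasurable (fun ξ => (ρ ξ : 𝓜(ℂ, A))) ν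
  act_eq : ∀ ξ b, S.tilde.act ξ b = ad (ρ ξ) b
  cocycle_eq : ∀ ξ η, (S.tilde.cocycle ξ η : 𝓜(ℂ, A)) =
    (ρ ξ : 𝓜(ℂ, A)) * ρ η * star (ρ (ξ * η) : 𝓜(ℂ, A))
  covariance : ∀ x ξ, extendMul (S.base.act x) (ρ ξ) = (S.κ x ξ : 𝓜(ℂ, A)) * ρ ξ

end CovariantStructure

/-! ### The Banach `⋆`-algebra `L¹` of a twisted action -/

section LOne

variable {G : Type v} [Group G] [TopologicalSpace G] [IsTopologicalGroup G]
  [LocallyCompactSpace G] [MeasurableSpace G]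
variable {A : Type u} [NonUnitalCStarAlgebra A]

/-- The modular function `Δ` of `G`, normalized by `∫ f(x y) dx = Δ(y)⁻¹ ∫ f(x) dx` for a left Haar
measure (Mathlib's `modularCharacter` is its inverse). -/
def modular (x : G) : ℝ := (Measure.modularCharacter x⁻¹ : NNReal)

/-- The product `(f ⋄ g)(x) = ∫ f(y) a_y[g(y⁻¹x)] α(y, y⁻¹x) dy`. -/
def conv (a : TwistedAction G A) (μ : Measure G) (f g : G → A) (x : G) : A :=
  ∫ y, (a.cocycle y (y⁻¹ * x) : 𝓜(ℂ, A)).snd (f y * a.act y (g (y⁻¹ * x))) ∂μ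

/-- The involution `f^⋄(x) = Δ(x)⁻¹ α(x, x⁻¹)⋆ a_x[f(x⁻¹)⋆]`. -/
def invol (a : TwistedAction G A) (f : G → A) (x : G) : A :=
  (modular x)⁻¹ • (star (a.cocycle x x⁻¹ : 𝓜(ℂ, A))).fst (a.act x (star (f x⁻¹)))

/-- A representation of the Banach `⋆`-algebra `L¹(G; A)` of the twisted action `a` by bounded
operators in a Hilbert space. (Contractivity is automatic for such representations. Hilbert spaces
in `Type` suffice: for separable `A` and second countable `G`, the space `L¹(G; A)` is separable, so
that its cyclic representations act in separable Hilbert spaces.) -/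
structure LOneRep (a : TwistedAction G A) (μ : Measure G) where
  H : Type
  [normed : NormedAddCommGroup H]
  [inner : InnerProductSpace ℂ H]
  [complete : CompleteSpace H]
  toFun : Lp A 1 μ →L[ℂ] (H →L[ℂ] H)
  norm_le : ∀ f, ‖toFun f‖ ≤ ‖f‖
  map_conv : ∀ f g h : Lp A 1 μ, h =ᵐ[μ] conv a μ f g → toFun h = toFun f * toFun g
  map_invol : ∀ f h : Lp A 1 μ, h =ᵐ[μ] invol a f → toFun h = star (toFun f)

attribute [instance] LOneRep.normed LOneRep.inner LOneRep.complete

/-- The `C⋆`-algebra of all bounded families of operators, indexed by the representations. -/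
abbrev BigAlgebra (a : TwistedAction G A) (μ : Measure G) :=
  lp (fun i : LOneRep a μ => i.H →L[ℂ] i.H) ∞

/-- The universal representation `f ↦ (Π f)_Π` of `L¹(G; A)`. The norm of the image of `f` is the
enveloping norm `sup_Π ‖Π f‖`. -/
def univRep (a : TwistedAction G A) (μ : Measure G) (f : Lp A 1 μ) : BigAlgebra a μ :=
  ⟨fun i => i.toFun f,
    memℓp_infty ⟨‖f‖, by rintro _ ⟨i, rfl⟩; exact i.norm_le f⟩⟩

/-- The twisted crossed product `A ⋊ G`: the enveloping `C⋆`-algebra of the Banach `⋆`-algebra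
`L¹(G; A)`, i.e. the closure of its image under the universal representation. (That image is a
`⋆`-subalgebra, since `univRep` turns `⋄` into the product and the involution into `star`.) -/
def crossedProductSubalgebra (a : TwistedAction G A) (μ : Measure G) :
    NonUnitalStarSubalgebra ℂ (BigAlgebra a μ) :=
  (NonUnitalStarAlgebra.adjoin ℂ (Set.range (univRep a μ))).topologicalClosure

/-- The twisted crossed product as a type. -/
def CrossedProduct (a : TwistedAction G A) (μ : Measure G) : Type (max 1 u v) :=
  crossedProductSubalgebra a μ

instance (a : TwistedAction G A) (μ : Measure G) : NonUnitalCStarAlgebra (CrossedProduct a μ) :=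
  have : IsClosed (crossedProductSubalgebra a μ : Set (BigAlgebra a μ)) :=
    NonUnitalStarSubalgebra.isClosed_topologicalClosure _
  NonUnitalStarSubalgebra.nonUnitalCStarAlgebra (crossedProductSubalgebra a μ)

/-- The canonical map `L¹(G; A) → A ⋊ G`. -/
def toCrossed (a : TwistedAction G A) (μ : Measure G) (f : Lp A 1 μ) : CrossedProduct a μ :=
  ⟨univRep a μ f, NonUnitalStarSubalgebra.le_topologicalClosure _
    (NonUnitalStarAlgebra.subset_adjoin ℂ _ ⟨f, rfl⟩)⟩

/-- The element `b` of the crossed product is (the image of) the function `f`, which is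
integrable. -/
def Represents (a : TwistedAction G A) (μ : Measure G) (b : CrossedProduct a μ) (f : G → A) :
    Prop :=
  ∃ hf : Integrable f μ, b = toCrossed a μ hf.toL1

/-- `[(δ_z ⊗ m) ⋄ g](x) = m a_z[g(z⁻¹x)] α(z, z⁻¹x)`. -/
def deltaLeft (a : TwistedAction G A) (z : G) (m : 𝓜(ℂ, A)) (g : G → A) (x : G) : A :=
  m.fst ((a.cocycle z (z⁻¹ * x) : 𝓜(ℂ, A)).snd (a.act z (g (z⁻¹ * x))))

/-- `[f ⋄ (δ_z ⊗ m)](x) = Δ(z)⁻¹ f(xz⁻¹) a_{xz⁻¹}(m) α(xz⁻¹, z)`. -/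
def deltaRight (a : TwistedAction G A) (z : G) (m : 𝓜(ℂ, A)) (f : G → A) (x : G) : A :=
  (modular z)⁻¹ • (a.cocycle (x * z⁻¹) z : 𝓜(ℂ, A)).snd
    ((extendMul (a.act (x * z⁻¹)) m).snd (f (x * z⁻¹)))

/-- The multiplier `M` of the crossed product is `δ_z ⊗ m`. (As the image of `L¹(G; A)` is dense,
this determines `M`.) -/
def IsDelta (a : TwistedAction G A) (μ : Measure G) (z : G) (m : 𝓜(ℂ, A))
    (M : 𝓜(ℂ, CrossedProduct a μ)) : Prop :=
  ∀ (f : G → A) (b : CrossedProduct a μ), Represents a μ b f →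
    Represents a μ (M.fst b) (deltaLeft a z m f) ∧ Represents a μ (M.snd b) (deltaRight a z m f)

end LOne

end CovStr

end

/-!
The crossed product is the closure of the image of `L¹`, so everything is built on functions
`f : Γ → A` and extended by density (`crossedProduct_induction`). All pointwise identities are
identities between words in the multiplier algebra `𝓜(ℂ, A)`, into which `A` embeds and to which
automorphisms extend; they reduce to the cocycle and covariance identities.

*Point masses.* In `L¹` one has
`(f^⋄ ⋄ g)(x) = ∫ a_y⁻¹[f(y)⋆ g(yx) α(y, x)⋆] dy` (`conv_invol_eq_integral`), which rests on the
inversion formula `∫ F(y⁻¹) Δ(y)⁻¹ dy = ∫ F(y) dy`. Under left multiplication by `δ_z ⊗ m` the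
integrand is merely translated by `z` (`innerKernel_deltaLeft`), so that this operator preserves
`f^⋄ ⋄ g`. By the `C⋆`-identity it is isometric for the enveloping norm, whence it extends to a
unitary multiplier of the crossed product (`exists_unitary_of_inner`). Its right action is
`f ↦ ((δ_z ⊗ m)^⋄ ⋄ f^⋄)^⋄`, which is computed in `invol_deltaLeftSymm_invol`.

*The automorphisms `c_x`.* The map `f ↦ a_x[f(·)] κ(x, ·)` is an isometric `⋆`-automorphism of `L¹`.
Composition with it permutes the representations of `L¹`, so it preserves the enveloping norm and
extends to the crossed product (`exists_automorphism`).

*Covariance.* The identity `c_x(δ_ξ ⊗ 1) = (δ_e ⊗ κ(x, ξ)) ⋄ (δ_ξ ⊗ 1)` is checked on functions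
(`lift_deltaLeft`). For an inner second action, this identity and the twisted action `(c, γ)` alone
imply all three identities of a covariant structure (`particular_tilde_act_cocycle` and its
neighbours).

*Measurability and continuity.* Joint measurability of the cocycle says nothing about a given
section `α(ξ, ·)`, nor about the antidiagonal, which may be a null set; the cocycle identity
supplies both (`TwistedAction.IsMeasurable.cocycle_left`, `TwistedAction.IsMeasurable.cocycle_inv`).
Families in the crossed product are measurable because a jointly measurable function with integrable sections
defines a measurable map into the separable space `L¹`, and continuous by dominated convergence. For
unitary multipliers only left multiplications need to be examined, as `‖U⋆ b - c‖ = ‖U c - b‖`.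
-/

noncomputable section

namespace CovStr

/-! ### Calculus in the multiplier algebra -/

section MultiplierCalculus

variable {A : Type u} [NonUnitalCStarAlgebra A]

theorem eq_of_forall_mul_left_eq {b c : A} (h : ∀ d : A, d * b = d * c) : b = c := by
  rw [← sub_eq_zero, ← CStarRing.star_mul_self_eq_zero_iff, mul_sub, h, sub_self]

theorem eq_of_forall_mul_right_eq {b c : A} (h : ∀ d : A, b * d = c * d) : b = c := by
  rw [← sub_eq_zero, ← CStarRing.mul_star_self_eq_zero_iff, sub_mul, h, sub_self]

theorem fst_mul (m : 𝓜(ℂ, A)) (b c : A) : m.fst (b * c) = m.fst b * c :=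
  eq_of_forall_mul_left_eq fun d => by rw [← m.central, ← mul_assoc, m.central, mul_assoc]

/-- A multiplier is determined by its left action, because `b A = 0` forces `b = 0`. -/
theorem multiplier_ext {m n : 𝓜(ℂ, A)} (h : ∀ b, m.fst b = n.fst b) : m = n := by
  refine DoubleCentralizer.ext _ _ _ _ (Prod.ext (ContinuousLinearMap.ext h)
    (ContinuousLinearMap.ext fun b => eq_of_forall_mul_right_eq fun d => ?_))
  rw [m.central, n.central, h]

theorem coe_fst_apply (m : 𝓜(ℂ, A)) (b : A) :
    ((m.fst b : A) : 𝓜(ℂ, A)) = m * (b : 𝓜(ℂ, A)) :=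
  multiplier_ext fun c => (fst_mul m b c).symm

theorem coe_snd_apply (m : 𝓜(ℂ, A)) (b : A) :
    ((m.snd b : A) : 𝓜(ℂ, A)) = (b : 𝓜(ℂ, A)) * m :=
  multiplier_ext fun c => m.central b c

theorem coe_mul (b c : A) : ((b * c : A) : 𝓜(ℂ, A)) = (b : 𝓜(ℂ, A)) * (c : 𝓜(ℂ, A)) :=
  map_mul (DoubleCentralizer.coeHom (𝕜 := ℂ) (A := A)) b c

theorem coe_star (b : A) : ((star b : A) : 𝓜(ℂ, A)) = star (b : 𝓜(ℂ, A)) :=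
  map_star (DoubleCentralizer.coeHom (𝕜 := ℂ) (A := A)) b

theorem coe_injective {b c : A} (h : (b : 𝓜(ℂ, A)) = (c : 𝓜(ℂ, A))) : b = c :=
  eq_of_forall_mul_right_eq fun d => congrArg (fun m : 𝓜(ℂ, A) => m.fst d) h

theorem extendMul_fst (φ : A ≃⋆ₐ[ℂ] A) (m : 𝓜(ℂ, A)) (b : A) :
    (extendMul φ m).fst b = φ (m.fst (φ.symm b)) := rfl

theorem extendMul_snd (φ : A ≃⋆ₐ[ℂ] A) (m : 𝓜(ℂ, A)) (b : A) :
    (extendMul φ m).snd b = φ (m.snd (φ.symm b)) := rfl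

theorem extendMul_mul (φ : A ≃⋆ₐ[ℂ] A) (m n : 𝓜(ℂ, A)) :
    extendMul φ (m * n) = extendMul φ m * extendMul φ n :=
  multiplier_ext fun b => by
    simp only [DoubleCentralizer.mul_fst, mul_apply_eq_comp, extendMul_fst,
      φ.symm_apply_apply]

theorem extendMul_one (φ : A ≃⋆ₐ[ℂ] A) : extendMul φ (1 : 𝓜(ℂ, A)) = 1 :=
  multiplier_ext fun b => φ.apply_symm_apply b

theorem extendMul_star (φ : A ≃⋆ₐ[ℂ] A) (m : 𝓜(ℂ, A)) :
    extendMul φ (star m) = star (extendMul φ m) :=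
  multiplier_ext fun b => by
    simp only [extendMul_fst, extendMul_snd, DoubleCentralizer.star_fst, map_star]

theorem coe_aut (φ : A ≃⋆ₐ[ℂ] A) (b : A) :
    ((φ b : A) : 𝓜(ℂ, A)) = extendMul φ (b : 𝓜(ℂ, A)) :=
  multiplier_ext fun c => by
    rw [extendMul_fst]
    change φ b * c = φ (b * φ.symm c)
    rw [map_mul, φ.apply_symm_apply]

theorem exists_aut_eq (φ : A ≃⋆ₐ[ℂ] A) (b : A) : ∃ c, φ c = b := ⟨φ.symm b, φ.apply_symm_apply b⟩

theorem extendMul_injective (φ : A ≃⋆ₐ[ℂ] A) {m n : 𝓜(ℂ, A)}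
    (h : extendMul φ m = extendMul φ n) : m = n :=
  multiplier_ext fun b => φ.injective <| by
    have := congrArg (fun k : 𝓜(ℂ, A) => k.fst (φ b)) h
    simp only [extendMul_fst, φ.symm_apply_apply] at this
    exact this

theorem coe_ad (m : unitary 𝓜(ℂ, A)) (b : A) :
    ((ad m b : A) : 𝓜(ℂ, A)) = (m : 𝓜(ℂ, A)) * (b : 𝓜(ℂ, A)) * star (m : 𝓜(ℂ, A)) := by
  rw [ad, coe_fst_apply, coe_snd_apply, mul_assoc]

theorem unitary_mul_star (u : unitary 𝓜(ℂ, A)) : (u : 𝓜(ℂ, A)) * star (u : 𝓜(ℂ, A)) = 1 :=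
  Unitary.mul_star_self_of_mem u.2

theorem unitary_star_mul (u : unitary 𝓜(ℂ, A)) : star (u : 𝓜(ℂ, A)) * (u : 𝓜(ℂ, A)) = 1 :=
  Unitary.star_mul_self_of_mem u.2

theorem unitary_mul_star_cancel (u : unitary 𝓜(ℂ, A)) (m : 𝓜(ℂ, A)) :
    (u : 𝓜(ℂ, A)) * (star (u : 𝓜(ℂ, A)) * m) = m := by
  rw [← mul_assoc, unitary_mul_star, one_mul]

theorem unitary_star_mul_cancel (u : unitary 𝓜(ℂ, A)) (m : 𝓜(ℂ, A)) :
    star (u : 𝓜(ℂ, A)) * ((u : 𝓜(ℂ, A)) * m) = m := by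
  rw [← mul_assoc, unitary_star_mul, one_mul]

/-- The extension of an automorphism to multipliers carries unitaries to unitaries. -/
def extendUnitary (φ : A ≃⋆ₐ[ℂ] A) (m : unitary 𝓜(ℂ, A)) : unitary 𝓜(ℂ, A) :=
  ⟨extendMul φ m, by
    rw [Unitary.mem_iff, ← extendMul_star, ← extendMul_mul, ← extendMul_mul]
    simp [extendMul_one]⟩

/-- The inner automorphism implemented by a unitary multiplier. -/
def adEquiv (m : unitary 𝓜(ℂ, A)) : A ≃⋆ₐ[ℂ] A where
  toFun := ad m
  invFun := ad (star m)
  left_inv b := coe_injective <| by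
    simp [coe_ad, mul_assoc, unitary_star_mul_cancel]
  right_inv b := coe_injective <| by
    simp [coe_ad, mul_assoc, unitary_mul_star_cancel]
  map_mul' b c := coe_injective <| by
    simp [coe_mul, coe_ad, mul_assoc, unitary_star_mul_cancel]
  map_add' b c := by simp [ad]
  map_star' b := coe_injective <| by
    simp [coe_ad, coe_star, mul_assoc]
  map_smul' c b := by simp [ad]

theorem extendMul_adEquiv (u : unitary 𝓜(ℂ, A)) (m : 𝓜(ℂ, A)) :
    extendMul (adEquiv u) m = (u : 𝓜(ℂ, A)) * m * star (u : 𝓜(ℂ, A)) :=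
  multiplier_ext fun b => coe_injective <| by
    have h : (adEquiv u).symm b = ad (star u) b := rfl
    have h' : ∀ c, adEquiv u c = ad u c := fun _ => rfl
    rw [extendMul_fst, h, h', coe_ad, coe_fst_apply, coe_ad, coe_fst_apply]
    simp [mul_assoc]

theorem extendMul_eq_of_fst {φ : A ≃⋆ₐ[ℂ] A} {m n : 𝓜(ℂ, A)}
    (h : ∀ b, φ (m.fst b) = n.fst (φ b)) : extendMul φ m = n :=
  multiplier_ext fun b => by rw [extendMul_fst, h, φ.apply_symm_apply]

theorem norm_aut (φ : A ≃⋆ₐ[ℂ] A) (b : A) : ‖φ b‖ = ‖b‖ :=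
  NonUnitalStarAlgHom.norm_map φ φ.injective b

theorem norm_coe (b : A) : ‖(b : 𝓜(ℂ, A))‖ = ‖b‖ :=
  NonUnitalStarAlgHom.norm_map (DoubleCentralizer.coeHom (𝕜 := ℂ) (A := A))
    (fun _ _ => coe_injective) b

theorem norm_unitary_fst (u : unitary 𝓜(ℂ, A)) (b : A) : ‖(u : 𝓜(ℂ, A)).fst b‖ = ‖b‖ := by
  rw [← norm_coe, coe_fst_apply, CStarRing.norm_coe_unitary_mul, norm_coe]

theorem norm_unitary_snd (u : unitary 𝓜(ℂ, A)) (b : A) : ‖(u : 𝓜(ℂ, A)).snd b‖ = ‖b‖ := by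
  rw [← norm_coe, coe_snd_apply, CStarRing.norm_mul_coe_unitary, norm_coe]

end MultiplierCalculus

/-! ### Pointwise identities of a twisted action -/

namespace TwistedAction

variable {G : Type v} {A : Type u} [Group G] [NonUnitalCStarAlgebra A] (a : TwistedAction G A)

theorem extendMul_act_one (m : 𝓜(ℂ, A)) : extendMul (a.act 1) m = m :=
  extendMul_eq_of_fst fun b => by rw [a.act_one, a.act_one]

theorem extendMul_act_act (x y : G) (m : 𝓜(ℂ, A)) :
    extendMul (a.act x) (extendMul (a.act y) m) =
      (a.cocycle x y : 𝓜(ℂ, A)) * extendMul (a.act (x * y)) m *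
        star (a.cocycle x y : 𝓜(ℂ, A)) := by
  refine multiplier_ext fun b => coe_injective ?_
  obtain ⟨c, rfl⟩ := exists_aut_eq (a.act x) b
  obtain ⟨c, rfl⟩ := exists_aut_eq (a.act y) c
  have h : ∀ (φ : A ≃⋆ₐ[ℂ] A) (n : 𝓜(ℂ, A)) (d : A), (extendMul φ n).fst (φ d) = φ (n.fst d) :=
    fun φ n d => by rw [extendMul_fst, φ.symm_apply_apply]
  rw [h, h, a.act_act, a.act_act, coe_ad, coe_fst_apply, coe_ad, coe_aut, coe_aut, coe_fst_apply,
    extendMul_mul]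
  simp only [mul_assoc, unitary_star_mul_cancel]

theorem extendMul_cocycle (x y z : G) :
    extendMul (a.act x) (a.cocycle y z) = (a.cocycle x y : 𝓜(ℂ, A)) * a.cocycle (x * y) z *
      star (a.cocycle x (y * z) : 𝓜(ℂ, A)) := by
  rw [a.cocycle_mul, mul_assoc, unitary_mul_star, mul_one]

/-- The inverse of `a_y` is `a_{y⁻¹}` up to the inner automorphism of `α(y⁻¹, y)⋆`. -/
theorem coe_act_symm (y : G) (b : A) :
    (((a.act y).symm b : A) : 𝓜(ℂ, A)) = star (a.cocycle y⁻¹ y : 𝓜(ℂ, A)) *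
      extendMul (a.act y⁻¹) (b : 𝓜(ℂ, A)) * (a.cocycle y⁻¹ y : 𝓜(ℂ, A)) := by
  obtain ⟨c, rfl⟩ := exists_aut_eq (a.act y) b
  rw [(a.act y).symm_apply_apply, coe_aut, extendMul_act_act, inv_mul_cancel, extendMul_act_one]
  simp only [mul_assoc, unitary_star_mul_cancel, unitary_star_mul, mul_one]

end TwistedAction

/-! ### The modular function -/

section Modular

variable {G : Type v} [Group G] [TopologicalSpace G] [IsTopologicalGroup G]
  [LocallyCompactSpace G]

theorem modular_mul (x y : G) : modular (x * y) = modular x * modular y := by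
  simp [modular, mul_comm]

theorem modular_one : modular (1 : G) = 1 := by simp [modular]

theorem modular_pos (x : G) : 0 < modular x := Measure.modularCharacterFun_pos _

theorem modular_inv (x : G) : modular x⁻¹ = (modular x)⁻¹ :=
  eq_inv_of_mul_eq_one_left (by rw [← modular_mul, inv_mul_cancel, modular_one])

theorem modular_inv_smul_eq {E : Type*} [NormedAddCommGroup E] [NormedSpace ℝ E] (y : G) (e : E) :
    (modular y)⁻¹ • e = Measure.modularCharacter y • e := by
  rw [← modular_inv, modular, inv_inv, NNReal.smul_def]

end Modular

/-! ### Pointwise identities for point masses -/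

section PointMass

variable {G : Type v} [Group G] {A : Type u} [NonUnitalCStarAlgebra A] (a : TwistedAction G A)

theorem coe_real_smul (r : ℝ) (b : A) : ((r • b : A) : 𝓜(ℂ, A)) = (r : ℂ) • (b : 𝓜(ℂ, A)) := by
  rw [← Complex.coe_smul]
  exact map_smul (DoubleCentralizer.coeHom (𝕜 := ℂ) (A := A)) (r : ℂ) b

theorem extendMul_smul (φ : A ≃⋆ₐ[ℂ] A) (c : ℂ) (m : 𝓜(ℂ, A)) :
    extendMul φ (c • m) = c • extendMul φ m :=
  multiplier_ext fun _ => map_smul φ c _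

theorem coe_deltaLeft (z : G) (m : 𝓜(ℂ, A)) (g : G → A) (x : G) :
    ((deltaLeft a z m g x : A) : 𝓜(ℂ, A)) = m * extendMul (a.act z) (g (z⁻¹ * x) : 𝓜(ℂ, A)) *
      (a.cocycle z (z⁻¹ * x) : 𝓜(ℂ, A)) := by
  rw [deltaLeft, coe_fst_apply, coe_snd_apply, coe_aut, mul_assoc]

/-- The inverse of left multiplication by `δ_z ⊗ m`, for a unitary multiplier `m`. -/
def deltaLeftSymm (z : G) (m : unitary 𝓜(ℂ, A)) (g : G → A) (x : G) : A :=
  (a.act z).symm ((star m : unitary 𝓜(ℂ, A)).1.fst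
    ((star (a.cocycle z x) : unitary 𝓜(ℂ, A)).1.snd (g (z * x))))

theorem coe_act_deltaLeftSymm (z : G) (m : unitary 𝓜(ℂ, A)) (g : G → A) (x : G) :
    extendMul (a.act z) ((deltaLeftSymm a z m g x : A) : 𝓜(ℂ, A)) =
      star (m : 𝓜(ℂ, A)) * (g (z * x) : 𝓜(ℂ, A)) * star (a.cocycle z x : 𝓜(ℂ, A)) := by
  rw [← coe_aut, deltaLeftSymm, StarAlgEquiv.apply_symm_apply, coe_fst_apply, coe_snd_apply,
    mul_assoc]
  rfl

theorem deltaLeft_deltaLeftSymm (z : G) (m : unitary 𝓜(ℂ, A)) (g : G → A) :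
    deltaLeft a z m (deltaLeftSymm a z m g) = g := by
  funext x
  refine coe_injective ?_
  rw [coe_deltaLeft, coe_act_deltaLeftSymm, mul_inv_cancel_left]
  simp only [mul_assoc, unitary_star_mul, mul_one, unitary_mul_star_cancel]

theorem deltaLeftSymm_deltaLeft (z : G) (m : unitary 𝓜(ℂ, A)) (g : G → A) :
    deltaLeftSymm a z m (deltaLeft a z m g) = g := by
  funext x
  refine coe_injective (extendMul_injective (a.act z) ?_)
  rw [coe_act_deltaLeftSymm, coe_deltaLeft, inv_mul_cancel_left]
  simp only [mul_assoc, unitary_mul_star, mul_one, unitary_star_mul_cancel]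

theorem deltaLeft_one_one (f : G → A) : deltaLeft a 1 1 f = f := by
  funext x
  refine coe_injective ?_
  rw [coe_deltaLeft, a.cocycle_one_left, a.extendMul_act_one, inv_one, one_mul, one_mul,
    OneMemClass.coe_one, mul_one]

theorem deltaLeft_one_apply (m : 𝓜(ℂ, A)) (f : G → A) (x : G) :
    deltaLeft a 1 m f x = m.fst (f x) := by
  rw [deltaLeft, a.cocycle_one_left, inv_one, one_mul, a.act_one]
  rfl

theorem deltaLeft_one_deltaLeft (m n : 𝓜(ℂ, A)) (z : G) (f : G → A) :
    deltaLeft a 1 m (deltaLeft a z n f) = deltaLeft a z (m * n) f := by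
  funext x
  refine coe_injective ?_
  rw [coe_deltaLeft, coe_deltaLeft, coe_deltaLeft, a.cocycle_one_left, a.extendMul_act_one, inv_one,
    one_mul, OneMemClass.coe_one, mul_one]
  simp only [mul_assoc]

/-- The product rule `(δ_y ⊗ 1) ⋄ (δ_z ⊗ 1) = δ_{yz} ⊗ α(y, z)`. -/
theorem deltaLeft_deltaLeft_one (y z : G) (f : G → A) :
    deltaLeft a y 1 (deltaLeft a z 1 f) = deltaLeft a (y * z) (a.cocycle y z) f := by
  funext x
  refine coe_injective ?_
  have h := a.extendMul_cocycle y z (z⁻¹ * (y⁻¹ * x))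
  rw [mul_inv_cancel_left] at h
  rw [coe_deltaLeft, coe_deltaLeft, coe_deltaLeft, one_mul, one_mul, extendMul_mul,
    a.extendMul_act_act, h, mul_inv_rev, mul_assoc z⁻¹]
  simp only [mul_assoc, unitary_star_mul, mul_one, unitary_star_mul_cancel]

/-- The integrand of the `L¹(G; A)`-valued inner product `f^⋄ ⋄ g`. -/
def innerKernel (f g : G → A) (x y : G) : A :=
  (a.act y).symm ((star (a.cocycle y x) : unitary 𝓜(ℂ, A)).1.snd (star (f y) * g (y * x)))

theorem coe_innerKernel (f g : G → A) (x y : G) :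
    extendMul (a.act y) ((innerKernel a f g x y : A) : 𝓜(ℂ, A)) =
      star (f y : 𝓜(ℂ, A)) * (g (y * x) : 𝓜(ℂ, A)) * star (a.cocycle y x : 𝓜(ℂ, A)) := by
  rw [← coe_aut, innerKernel, StarAlgEquiv.apply_symm_apply, coe_snd_apply, coe_mul, coe_star]
  rfl

/-- Left multiplication by `δ_z ⊗ m` preserves the inner product `f^⋄ ⋄ g`: on its integrand it is
translation by `z`. -/
theorem innerKernel_deltaLeft (z : G) (m : unitary 𝓜(ℂ, A)) (f g : G → A) (x y : G) :
    innerKernel a (deltaLeft a z m f) (deltaLeft a z m g) x (z * y) = innerKernel a f g x y := by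
  refine coe_injective (extendMul_injective (a.act (z * y)) ?_)
  have h := a.extendMul_act_act z y ((innerKernel a f g x y : A) : 𝓜(ℂ, A))
  rw [coe_innerKernel] at h
  have h' : extendMul (a.act (z * y)) ((innerKernel a f g x y : A) : 𝓜(ℂ, A)) =
      star (a.cocycle z y : 𝓜(ℂ, A)) * extendMul (a.act z)
        (star (f y : 𝓜(ℂ, A)) * (g (y * x) : 𝓜(ℂ, A)) * star (a.cocycle y x : 𝓜(ℂ, A))) *
          (a.cocycle z y : 𝓜(ℂ, A)) := by
    rw [h]
    simp only [mul_assoc, unitary_star_mul, mul_one, unitary_star_mul_cancel]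
  rw [h', coe_innerKernel, coe_deltaLeft, coe_deltaLeft, inv_mul_cancel_left, mul_assoc z y x,
    inv_mul_cancel_left]
  simp only [extendMul_mul, extendMul_star, a.extendMul_cocycle, star_mul, star_star, mul_assoc,
    unitary_star_mul, mul_one, unitary_star_mul_cancel]

end PointMass

section Involution

variable {G : Type v} [Group G] [TopologicalSpace G] [IsTopologicalGroup G]
  [LocallyCompactSpace G] {A : Type u} [NonUnitalCStarAlgebra A] (a : TwistedAction G A)

theorem coe_deltaRight (z : G) (m : 𝓜(ℂ, A)) (f : G → A) (x : G) :
    ((deltaRight a z m f x : A) : 𝓜(ℂ, A)) = ((modular z : ℂ))⁻¹ • ((f (x * z⁻¹) : 𝓜(ℂ, A)) *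
      extendMul (a.act (x * z⁻¹)) m * (a.cocycle (x * z⁻¹) z : 𝓜(ℂ, A))) := by
  rw [deltaRight, coe_real_smul, coe_snd_apply, coe_snd_apply, Complex.ofReal_inv]

theorem coe_invol (f : G → A) (x : G) :
    ((invol a f x : A) : 𝓜(ℂ, A)) = ((modular x : ℂ))⁻¹ • (star (a.cocycle x x⁻¹ : 𝓜(ℂ, A)) *
      extendMul (a.act x) (star (f x⁻¹ : 𝓜(ℂ, A)))) := by
  rw [invol, coe_real_smul, coe_fst_apply, coe_aut, coe_star, Complex.ofReal_inv]

/-- Right multiplication by `δ_z ⊗ m` is `f ↦ ((δ_z ⊗ m)^⋄ ⋄ f^⋄)^⋄`. -/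
theorem invol_deltaLeftSymm_invol (z : G) (m : unitary 𝓜(ℂ, A)) (f : G → A) :
    invol a (deltaLeftSymm a z m (invol a f)) = deltaRight a z m f := by
  funext t
  obtain ⟨x, rfl⟩ : ∃ x, t = x * z := ⟨t * z⁻¹, by group⟩
  refine coe_injective ?_
  have hz : (modular z : ℂ) ≠ 0 := Complex.ofReal_ne_zero.2 (modular_pos z).ne'
  have hx : (modular x : ℂ) ≠ 0 := Complex.ofReal_ne_zero.2 (modular_pos x).ne'
  have key : ∀ w : 𝓜(ℂ, A), extendMul (a.act (x * z)) w = star (a.cocycle x z : 𝓜(ℂ, A)) *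
      extendMul (a.act x) (extendMul (a.act z) w) * (a.cocycle x z : 𝓜(ℂ, A)) := fun w => by
    rw [a.extendMul_act_act]
    simp only [mul_assoc, unitary_star_mul, mul_one, unitary_star_mul_cancel]
  have h1 := a.extendMul_cocycle x z (z⁻¹ * x⁻¹)
  have h2 := a.extendMul_cocycle x x⁻¹ x
  simp only [mul_inv_cancel, inv_mul_cancel, a.cocycle_one_left, a.cocycle_one_right,
    OneMemClass.coe_one, star_one, mul_one, mul_inv_cancel_left] at h1 h2
  rw [coe_invol, coe_deltaRight, key, extendMul_star, coe_act_deltaLeftSymm, coe_invol,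
    mul_inv_cancel_right]
  have e2 : (x * z)⁻¹ = z⁻¹ * x⁻¹ := by group
  have h3 := a.extendMul_act_act x x⁻¹ (f x : 𝓜(ℂ, A))
  rw [mul_inv_cancel, a.extendMul_act_one] at h3
  simp only [mul_inv_cancel_left, inv_inv, star_mul, star_smul, star_star, extendMul_mul,
    extendMul_star,
    extendMul_smul, mul_smul_comm, smul_mul_assoc, h1, h2, e2, h3, mul_assoc, modular_inv,
    modular_mul]
  simp only [unitary_star_mul_cancel, smul_smul, star_inv₀, Complex.star_def, Complex.conj_ofReal,
    Complex.ofReal_mul, Complex.ofReal_inv]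
  congr 1
  field_simp

/-- The integrand of `f^⋄ ⋄ g`, after the substitution `y ↦ y⁻¹`. -/
theorem conv_invol_integrand (f g : G → A) (x y : G) :
    (modular y)⁻¹ • (a.cocycle y⁻¹ (y⁻¹⁻¹ * x) : 𝓜(ℂ, A)).snd
      (invol a f y⁻¹ * a.act y⁻¹ (g (y⁻¹⁻¹ * x))) = innerKernel a f g x y := by
  refine coe_injective ?_
  have hy : (modular y : ℂ) ≠ 0 := Complex.ofReal_ne_zero.2 (modular_pos y).ne'
  have h := a.extendMul_cocycle y⁻¹ y x
  simp only [inv_mul_cancel, a.cocycle_one_left, OneMemClass.coe_one, mul_one] at h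
  rw [coe_real_smul, coe_snd_apply, coe_mul, coe_invol, coe_aut, innerKernel, a.coe_act_symm,
    coe_snd_apply, coe_mul, coe_star, inv_inv]
  simp only [extendMul_mul, extendMul_star, Unitary.coe_star, h, star_mul, star_star, mul_assoc,
    unitary_star_mul, mul_one, smul_mul_assoc, smul_smul, modular_inv, Complex.ofReal_inv, inv_inv]
  rw [inv_mul_cancel₀ hy, one_smul]

end Involution

/-! ### Measurability of vector-valued maps -/

section Measurability

variable {X : Type*} [MeasurableSpace X] {μ : Measure X}

/-- Carathéodory composition: a strongly measurable family of operators may be applied to a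
strongly measurable function. -/
theorem aestronglyMeasurable_clm_apply {E F : Type*} [NormedAddCommGroup E] [NormedSpace ℂ E]
    [NormedAddCommGroup F] [NormedSpace ℂ F] {Φ : X → E →L[ℂ] F}
    (hΦ : ∀ b, AEStronglyMeasurable (fun x => Φ x b) μ) {f : X → E}
    (hf : AEStronglyMeasurable f μ) : AEStronglyMeasurable (fun x => Φ x (f x)) μ := by
  obtain ⟨g, hg, hfg⟩ := hf
  suffices h : AEStronglyMeasurable (fun x => Φ x (g x)) μ from
    h.congr (hfg.mono fun x hx => by simp only [hx])
  have hs : ∀ s : SimpleFunc X E, AEStronglyMeasurable (fun x => Φ x (s x)) μ := by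
    intro s
    classical
    induction s with
    | const c => exact hΦ c
    | @pcw f g s hs hf hg =>
      refine (hf.restrict.piecewise hs hg.restrict).congr (Filter.Eventually.of_forall fun x => ?_)
      by_cases hx : x ∈ s <;> simp [Set.piecewise, hx]
  exact aestronglyMeasurable_of_tendsto_ae Filter.atTop (fun n => hs (hg.approx n))
    (Filter.Eventually.of_forall fun x => ((Φ x).continuous.tendsto _).comp (hg.tendsto_approx x))

/-- A map into a separable metric space is measurable as soon as its distances to all points are. -/
theorem aestronglyMeasurable_of_dist {E : Type*} [MetricSpace E]
    [TopologicalSpace.SeparableSpace E] {u : X → E}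
    (h : ∀ g, AEStronglyMeasurable (fun x => dist (u x) g) μ) : AEStronglyMeasurable u μ := by
  rcases isEmpty_or_nonempty E with hE | hE
  · have : IsEmpty X := ⟨fun x => hE.elim (u x)⟩
    rw [Measure.eq_zero_of_isEmpty μ]
    exact aestronglyMeasurable_zero_measure u
  let g := TopologicalSpace.denseSeq E
  have hg : DenseRange g := TopologicalSpace.denseRange_denseSeq E
  have hemb : IsInducing (fun (e : E) (n : ℕ) => dist e (g n)) := by
    refine isInducing_iff_nhds.2 fun x => le_antisymm ?_ ?_
    · exact (Continuous.tendsto (by fun_prop) x).le_comap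
    · refine (Metric.nhds_basis_ball.ge_iff).2 fun ε hε => ?_
      obtain ⟨n, hn⟩ := hg.exists_dist_lt x (half_pos hε)
      refine ⟨{v | v n < ε / 2}, (isOpen_lt (continuous_apply n) continuous_const).mem_nhds hn, ?_⟩
      intro y hy
      have hy' : dist y (g n) < ε / 2 := hy
      calc dist y x ≤ dist y (g n) + dist x (g n) := dist_triangle_right _ _ _
        _ < ε := by linarith
  refine (IsEmbedding.aestronglyMeasurable_comp_iff ⟨hemb, hemb.injective⟩).1 ?_
  exact (aemeasurable_pi_lambda _ fun n => (h (g n)).aemeasurable).aestronglyMeasurable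

/-- A jointly measurable function with integrable sections defines a measurable map into `L¹`. -/
theorem aestronglyMeasurable_toL1 {Y : Type*} [MeasurableSpace Y]
    [MeasurableSpace.CountablyGenerated Y] {ν : Measure Y} [SFinite ν]
    {E : Type*} [NormedAddCommGroup E] [TopologicalSpace.SeparableSpace E] {F : X → Y → E}
    (hF : AEStronglyMeasurable (fun p : X × Y => F p.1 p.2) (μ.prod ν))
    (hi : ∀ x, Integrable (F x) ν) : AEStronglyMeasurable (fun x => (hi x).toL1 (F x)) μ := by
  have : Fact ((1 : ℝ≥0∞) ≠ ∞) := ⟨ENNReal.one_ne_top⟩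
  refine aestronglyMeasurable_of_dist fun g => ?_
  have h1 : AEStronglyMeasurable (fun p : X × Y => ‖F p.1 p.2 - g p.2‖) (μ.prod ν) :=
    (hF.sub (Lp.aestronglyMeasurable g).comp_snd).norm
  refine h1.integral_prod_right'.congr (Filter.Eventually.of_forall fun x => ?_)
  simp only
  rw [dist_eq_norm, L1.norm_eq_integral_norm]
  refine integral_congr_ae ?_
  filter_upwards [Lp.coeFn_sub ((hi x).toL1 (F x)) g, (hi x).coeFn_toL1] with y h2 h3
  rw [h2, Pi.sub_apply, h3]

end Measurability

/-! ### Strictly measurable families of multipliers -/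

section Strict

variable {X : Type*} [MeasurableSpace X] {μ : Measure X} {A : Type u} [NonUnitalCStarAlgebra A]

theorem StrictMeasurable.fst_apply {m : X → 𝓜(ℂ, A)} (hm : StrictMeasurable m μ) {f : X → A}
    (hf : AEStronglyMeasurable f μ) : AEStronglyMeasurable (fun x => (m x).fst (f x)) μ :=
  aestronglyMeasurable_clm_apply (fun b => (hm b).1) hf

theorem StrictMeasurable.snd_apply {m : X → 𝓜(ℂ, A)} (hm : StrictMeasurable m μ) {f : X → A}
    (hf : AEStronglyMeasurable f μ) : AEStronglyMeasurable (fun x => (m x).snd (f x)) μ :=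
  aestronglyMeasurable_clm_apply (fun b => (hm b).2) hf

theorem aestronglyMeasurable_aut_apply {φ : X → A ≃⋆ₐ[ℂ] A}
    (hφ : ∀ b, AEStronglyMeasurable (fun x => φ x b) μ) {f : X → A}
    (hf : AEStronglyMeasurable f μ) : AEStronglyMeasurable (fun x => φ x (f x)) μ :=
  aestronglyMeasurable_clm_apply (Φ := fun x => autCLM (φ x)) hφ hf

theorem aestronglyMeasurable_aut_symm [TopologicalSpace.SeparableSpace A] {φ : X → A ≃⋆ₐ[ℂ] A}
    (hφ : ∀ b, AEStronglyMeasurable (fun x => φ x b) μ) (b : A) :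
    AEStronglyMeasurable (fun x => (φ x).symm b) μ := by
  refine aestronglyMeasurable_of_dist fun c => ((hφ c).sub (aestronglyMeasurable_const
    (b := b))).norm.congr (Filter.Eventually.of_forall fun x => ?_)
  obtain ⟨d, rfl⟩ := exists_aut_eq (φ x) b
  simp only [Pi.sub_apply]
  rw [(φ x).symm_apply_apply, ← map_sub, norm_aut, dist_comm, dist_eq_norm]

theorem StrictMeasurable.const (m : 𝓜(ℂ, A)) : StrictMeasurable (fun _ : X => m) μ :=
  fun _ => ⟨aestronglyMeasurable_const, aestronglyMeasurable_const⟩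

theorem StrictMeasurable.mul {m n : X → 𝓜(ℂ, A)} (hm : StrictMeasurable m μ)
    (hn : StrictMeasurable n μ) : StrictMeasurable (fun x => m x * n x) μ :=
  fun b => ⟨hm.fst_apply (hn b).1, hn.snd_apply (hm b).2⟩

theorem StrictMeasurable.star {m : X → 𝓜(ℂ, A)} (hm : StrictMeasurable m μ) :
    StrictMeasurable (fun x => star (m x)) μ :=
  fun b => ⟨continuous_star.comp_aestronglyMeasurable (hm (Star.star b)).2,
    continuous_star.comp_aestronglyMeasurable (hm (Star.star b)).1⟩

theorem StrictMeasurable.extendMul [TopologicalSpace.SeparableSpace A] {m : X → 𝓜(ℂ, A)}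
    (hm : StrictMeasurable m μ) {φ : X → A ≃⋆ₐ[ℂ] A}
    (hφ : ∀ b, AEStronglyMeasurable (fun x => φ x b) μ) :
    StrictMeasurable (fun x => extendMul (φ x) (m x)) μ :=
  fun b => ⟨aestronglyMeasurable_aut_apply hφ (hm.fst_apply (aestronglyMeasurable_aut_symm hφ b)),
    aestronglyMeasurable_aut_apply hφ (hm.snd_apply (aestronglyMeasurable_aut_symm hφ b))⟩

theorem StrictMeasurable.comp {Y : Type*} [MeasurableSpace Y] {ν : Measure Y} {m : X → 𝓜(ℂ, A)}
    (hm : StrictMeasurable m μ) {τ : Y → X} (hτ : Measure.QuasiMeasurePreserving τ ν μ) :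
    StrictMeasurable (fun y => m (τ y)) ν :=
  fun b => ⟨(hm b).1.comp_quasiMeasurePreserving hτ, (hm b).2.comp_quasiMeasurePreserving hτ⟩

/-- Almost all sections of a jointly strictly measurable family are strictly measurable. -/
theorem StrictMeasurable.ae_section [TopologicalSpace.SeparableSpace A] {Y : Type*}
    [MeasurableSpace Y] {ν : Measure Y} [SFinite ν] {m : X × Y → 𝓜(ℂ, A)}
    (hm : StrictMeasurable m (μ.prod ν)) : ∀ᵐ x ∂μ, StrictMeasurable (fun y => m (x, y)) ν := by
  have hd := TopologicalSpace.denseRange_denseSeq A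
  filter_upwards [ae_all_iff.2 fun n => (hm (TopologicalSpace.denseSeq A n)).1.prodMk_left,
    ae_all_iff.2 fun n => (hm (TopologicalSpace.denseSeq A n)).2.prodMk_left] with x h1 h2 b
  obtain ⟨s, hs, hsb⟩ := mem_closure_iff_seq_limit.1 (hd b)
  choose k hk using hs
  constructor
  · exact aestronglyMeasurable_of_tendsto_ae Filter.atTop (fun n => h1 (k n))
      (Filter.Eventually.of_forall fun y => by
        simpa only [hk, Function.comp_def] using (((m (x, y)).fst.continuous.tendsto b).comp hsb))
  · exact aestronglyMeasurable_of_tendsto_ae Filter.atTop (fun n => h2 (k n))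
      (Filter.Eventually.of_forall fun y => by
        simpa only [hk, Function.comp_def] using (((m (x, y)).snd.continuous.tendsto b).comp hsb))

end Strict

/-! ### Inversion of the Haar measure -/

section Inversion

variable {G : Type v} [Group G] [TopologicalSpace G] [IsTopologicalGroup G]
  [LocallyCompactSpace G] [SecondCountableTopology G] [MeasurableSpace G] [BorelSpace G]
  (μ : Measure G) [μ.IsHaarMeasure]

open Measure in
theorem map_mul_right_eq_modularCharacter_smul (g : G) :
    μ.map (· * g) = (modularCharacter g : ℝ≥0∞) • μ := by
  rw [show modularCharacter g = haarScalarFactor (μ.map (· * g)) μ from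
    modularCharacterFun_eq_haarScalarFactor μ g]
  exact isMulLeftInvariant_eq_smul _ μ

open Measure in
theorem lintegral_mul_right_eq_modularCharacter_mul (g : G) (f : G → ℝ≥0∞) :
    ∫⁻ x, f (x * g) ∂μ = (modularCharacter g : ℝ≥0∞) * ∫⁻ x, f x ∂μ := by
  rw [← smul_eq_mul, ← lintegral_smul_measure, ← map_mul_right_eq_modularCharacter_smul]
  exact (lintegral_map_equiv f (MeasurableEquiv.mulRight g)).symm

open Measure in
theorem measurable_modularCharacter : Measurable (fun x : G => (modularCharacter x : ℝ≥0∞)) := by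
  let μ : Measure G := haar
  obtain ⟨K, hK1, hK, hKc⟩ := exists_mem_nhds_isCompact_isClosed (1 : G)
  have h0 : μ K ≠ 0 := (measure_pos_of_mem_nhds μ hK1).ne'
  have h : (fun x : G => (modularCharacter x : ℝ≥0∞)) =
      fun x => μ ((fun y => y * x) ⁻¹' K) / μ K := by
    funext x
    rw [← Measure.map_apply (measurable_mul_const x) hKc.measurableSet,
      map_mul_right_eq_modularCharacter_smul, Measure.smul_apply, smul_eq_mul,
      ENNReal.mul_div_cancel_right h0 hK.measure_lt_top.ne]
  rw [h]
  exact (measurable_measure_mul_right μ hKc.measurableSet).div_const _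

open Measure in
/-- The inversion formula `∫ g(y⁻¹) Δ(y)⁻¹ dy = ∫ g(y) dy`. For a function `f` with
`0 < ∫ f < ∞`, the product `∫ f · ∫ g(y⁻¹) Δ(y)⁻¹ dy` is computed by Tonelli's theorem after
translating `y` by `x` on the left. -/
theorem lintegral_inv_mul_modularCharacter {g : G → ℝ≥0∞} (hg : Measurable g) :
    ∫⁻ y, modularCharacter y * g y⁻¹ ∂μ = ∫⁻ y, g y ∂μ := by
  obtain ⟨K, hK1, hK, hKc⟩ := exists_mem_nhds_isCompact_isClosed (1 : G)
  have h0 : μ K ≠ 0 := (measure_pos_of_mem_nhds μ hK1).ne'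
  let f : G → ℝ≥0∞ := K.indicator 1
  have hf : Measurable f := measurable_one.indicator hKc.measurableSet
  have hfK : ∫⁻ x, f x ∂μ = μ K := lintegral_indicator_one hKc.measurableSet
  have hD := measurable_modularCharacter (G := G)
  have hinv : ∀ y : G, (modularCharacter y : ℝ≥0∞) * (modularCharacter y⁻¹ : ℝ≥0∞) = 1 := fun y => by
    rw [← ENNReal.coe_mul, ← map_mul, mul_inv_cancel, map_one, ENNReal.coe_one]
  have htr := lintegral_mul_right_eq_modularCharacter_mul μ
  generalize hDdef : (fun y : G => (modularCharacter y : ℝ≥0∞)) = D at hD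
  have hDy : ∀ y, (modularCharacter y : ℝ≥0∞) = D y := fun y => congrFun hDdef y
  simp only [hDy] at hinv htr ⊢
  have key : (∫⁻ x, f x ∂μ) * ∫⁻ y, D y * g y⁻¹ ∂μ = (∫⁻ x, f x ∂μ) * ∫⁻ y, g y ∂μ :=
    calc (∫⁻ x, f x ∂μ) * ∫⁻ y, D y * g y⁻¹ ∂μ
        = ∫⁻ x, f x * ∫⁻ y, D y * g y⁻¹ ∂μ ∂μ := (lintegral_mul_const _ hf).symm
      _ = ∫⁻ x, ∫⁻ y, f x * (D (x⁻¹ * y) * g (y⁻¹ * x)) ∂μ ∂μ := by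
          refine lintegral_congr fun x => ?_
          rw [← lintegral_mul_left_eq_self _ x⁻¹, ← lintegral_const_mul]
          · simp only [mul_inv_rev, inv_inv]
          · fun_prop
      _ = ∫⁻ y, ∫⁻ x, f x * (D (x⁻¹ * y) * g (y⁻¹ * x)) ∂μ ∂μ :=
          lintegral_lintegral_swap (by fun_prop)
      _ = ∫⁻ y, ∫⁻ x, f (y * x) * (D x⁻¹ * g x) ∂μ ∂μ := by
          refine lintegral_congr fun y => ?_
          rw [← lintegral_mul_left_eq_self _ y]
          refine lintegral_congr fun x => ?_
          rw [inv_mul_cancel_left, mul_inv_rev, inv_mul_cancel_right]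
      _ = ∫⁻ x, ∫⁻ y, f (y * x) * (D x⁻¹ * g x) ∂μ ∂μ :=
          lintegral_lintegral_swap (by fun_prop)
      _ = ∫⁻ x, (∫⁻ x, f x ∂μ) * g x ∂μ := by
          refine lintegral_congr fun x => ?_
          rw [lintegral_mul_const _ (by fun_prop), htr, mul_comm (D x), mul_assoc,
            ← mul_assoc (D x), hinv, one_mul]
      _ = (∫⁻ x, f x ∂μ) * ∫⁻ y, g y ∂μ := lintegral_const_mul _ hg
  rw [hfK] at key
  exact (ENNReal.mul_right_inj h0 hK.measure_lt_top.ne).1 key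

open Measure in
theorem map_inv_withDensity_modularCharacter :
    (μ.withDensity fun y => (modularCharacter y : ℝ≥0∞)).map (MeasurableEquiv.inv G) = μ := by
  refine Measure.ext fun s hs => ?_
  have h := lintegral_inv_mul_modularCharacter μ (measurable_one.indicator hs)
  rw [lintegral_indicator_one hs] at h
  rw [MeasurableEquiv.map_apply, withDensity_apply _ ((MeasurableEquiv.inv G).measurable hs), ← h,
    ← lintegral_indicator ((MeasurableEquiv.inv G).measurable hs)]
  refine lintegral_congr fun y => ?_
  by_cases hy : y⁻¹ ∈ s
  · simp [hy]
  · simp [hy]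

theorem measurable_modular_inv : Measurable (fun y : G => (modular y)⁻¹) := by
  have h : (fun y : G => (modular y)⁻¹) =
      fun y => ((Measure.modularCharacter y : ℝ≥0∞)).toReal := by
    funext y
    rw [← modular_inv, modular, inv_inv, ENNReal.coe_toReal]
  rw [h]
  exact measurable_modularCharacter.ennreal_toReal

theorem measurable_modularCharacter_nnreal :
    Measurable (fun x : G => Measure.modularCharacter x) :=
  measurable_modularCharacter.ennreal_toNNReal

variable {E : Type*} [NormedAddCommGroup E] [NormedSpace ℝ E]

theorem integral_modular_inv_smul_inv (F : G → E) :
    ∫ y, (modular y)⁻¹ • F y⁻¹ ∂μ = ∫ y, F y ∂μ := by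
  conv_rhs => rw [← map_inv_withDensity_modularCharacter μ]
  rw [integral_map_equiv, integral_withDensity_eq_integral_smul measurable_modularCharacter_nnreal]
  exact integral_congr_ae (Filter.Eventually.of_forall fun y => modular_inv_smul_eq y _)

theorem integrable_modular_inv_smul_inv {F : G → E} (hF : Integrable F μ) :
    Integrable (fun y => (modular y)⁻¹ • F y⁻¹) μ := by
  rw [← map_inv_withDensity_modularCharacter μ, integrable_map_equiv,
    integrable_withDensity_iff_integrable_smul measurable_modularCharacter_nnreal] at hF
  exact hF.congr (Filter.Eventually.of_forall fun y => (modular_inv_smul_eq y _).symm)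

end Inversion

/-! ### Measurability of the cocycle on sections and on the antidiagonal -/

section CocycleSections

variable {G : Type v} [Group G] [TopologicalSpace G] [IsTopologicalGroup G]
  [LocallyCompactSpace G] [SecondCountableTopology G] [MeasurableSpace G] [BorelSpace G]
  {μ : Measure G} [μ.IsHaarMeasure]
  {A : Type u} [NonUnitalCStarAlgebra A] [TopologicalSpace.SeparableSpace A]
  {a : TwistedAction G A}

/-- Joint measurability controls only almost all sections `α(ξ, ·)`. Writing `ξ = η (η⁻¹ ξ)` with
both factors outside the exceptional null set, the cocycle identity gives all of them. -/
theorem TwistedAction.IsMeasurable.cocycle_left (ha : a.IsMeasurable μ) (ξ : G) :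
    StrictMeasurable (fun z => (a.cocycle ξ z : 𝓜(ℂ, A))) μ := by
  have h1 : ∀ᵐ η ∂μ, StrictMeasurable (fun z => (a.cocycle η z : 𝓜(ℂ, A))) μ := ha.2.ae_section
  have hq : Measure.QuasiMeasurePreserving (fun η : G => η⁻¹ * ξ) μ μ :=
    (quasiMeasurePreserving_mul_right μ ξ).comp (quasiMeasurePreserving_inv μ)
  obtain ⟨η, h2, h3⟩ := (h1.and (hq.ae h1)).exists
  have h : ∀ z, (a.cocycle ξ z : 𝓜(ℂ, A)) = star (a.cocycle η (η⁻¹ * ξ) : 𝓜(ℂ, A)) *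
      (extendMul (a.act η) (a.cocycle (η⁻¹ * ξ) z) * a.cocycle η (η⁻¹ * ξ * z)) := fun z => by
    rw [← a.cocycle_mul, mul_inv_cancel_left, unitary_star_mul_cancel]
  simp only [h]
  exact (StrictMeasurable.const _).mul ((h3.extendMul fun b => aestronglyMeasurable_const).mul
    (h2.comp (measurePreserving_mul_left μ (η⁻¹ * ξ)).quasiMeasurePreserving))

/-- The antidiagonal is a null set in general, but the cocycle identity
`α(x, x⁻¹) = a_x[α(x⁻¹, z)] α(x, x⁻¹ z)` gives the measurability of `α` on it, for generic `z`. -/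
theorem TwistedAction.IsMeasurable.cocycle_inv (ha : a.IsMeasurable μ) :
    StrictMeasurable (fun x => (a.cocycle x x⁻¹ : 𝓜(ℂ, A))) μ := by
  have h1 : ∀ᵐ z ∂μ, StrictMeasurable (fun x => (a.cocycle x z : 𝓜(ℂ, A))) μ :=
    (ha.2.comp Measure.measurePreserving_swap.quasiMeasurePreserving).ae_section
  have h2 : ∀ᵐ z ∂μ, StrictMeasurable (fun x => (a.cocycle x (x⁻¹ * z) : 𝓜(ℂ, A))) μ :=
    ((ha.2.comp (measurePreserving_prod_inv_mul μ μ).quasiMeasurePreserving).comp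
      Measure.measurePreserving_swap.quasiMeasurePreserving).ae_section
  obtain ⟨z, h3, h4⟩ := (h1.and h2).exists
  have h : ∀ x, (a.cocycle x x⁻¹ : 𝓜(ℂ, A)) =
      extendMul (a.act x) (a.cocycle x⁻¹ z) * a.cocycle x (x⁻¹ * z) := fun x => by
    rw [← a.cocycle_mul, mul_inv_cancel, a.cocycle_one_left, OneMemClass.coe_one, mul_one]
  simp only [h]
  exact ((h3.comp (quasiMeasurePreserving_inv μ)).extendMul ha.1).mul h4

end CocycleSections

/-! ### Integrability of products and adjoints -/

section Integrability

variable {G : Type v} [Group G] [TopologicalSpace G] [IsTopologicalGroup G]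
  [LocallyCompactSpace G] [SecondCountableTopology G] [MeasurableSpace G] [BorelSpace G]
  {μ : Measure G} [μ.IsHaarMeasure]

theorem ae_eq_comp_inv_mul {E : Type*} {f g : G → E} (h : f =ᵐ[μ] g) (x : G) :
    (fun y => f (y⁻¹ * x)) =ᵐ[μ] fun y => g (y⁻¹ * x) :=
  ((quasiMeasurePreserving_mul_right μ x).comp (quasiMeasurePreserving_inv μ)).ae_eq h

variable {A : Type u} [NonUnitalCStarAlgebra A] {a : TwistedAction G A}

theorem conv_congr {f f' g g' : G → A} (hf : f =ᵐ[μ] f') (hg : g =ᵐ[μ] g') :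
    conv a μ f g = conv a μ f' g' := by
  funext x
  refine integral_congr_ae ?_
  filter_upwards [hf, ae_eq_comp_inv_mul hg x] with y h1 h2
  rw [h1, h2]

theorem invol_congr {f f' : G → A} (hf : f =ᵐ[μ] f') : invol a f =ᵐ[μ] invol a f' := by
  filter_upwards [(quasiMeasurePreserving_inv μ).ae_eq hf] with x hx
  simp only [Function.comp_apply] at hx
  rw [invol, invol, hx]

theorem integrable_conv (ha : a.IsMeasurable μ) {f g : G → A} (hf : Integrable f μ)
    (hg : Integrable g μ) : Integrable (conv a μ f g) μ := by
  have hτ := measurePreserving_prod_inv_mul μ μ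
  have hm : AEStronglyMeasurable (fun p : G × G => (a.cocycle p.1 (p.1⁻¹ * p.2) : 𝓜(ℂ, A)).snd
      (f p.1 * a.act p.1 (g (p.1⁻¹ * p.2)))) (μ.prod μ) := by
    refine (ha.2.comp hτ.quasiMeasurePreserving).snd_apply
      (hf.aestronglyMeasurable.comp_fst.mul ?_)
    exact aestronglyMeasurable_aut_apply (φ := fun p : G × G => a.act p.1)
      (fun b => (ha.1 b).comp_fst)
      (hg.aestronglyMeasurable.comp_snd.comp_measurePreserving hτ)
  refine Integrable.integral_prod_right
    (((hτ.integrable_comp_of_integrable (hf.norm.mul_prod hg.norm))).mono hm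
    (Filter.Eventually.of_forall fun p => ?_))
  rw [norm_unitary_snd]
  refine (norm_mul_le _ _).trans (le_of_eq ?_)
  simp [norm_aut]

variable [TopologicalSpace.SeparableSpace A]

theorem integrable_invol (ha : a.IsMeasurable μ) {f : G → A} (hf : Integrable f μ) :
    Integrable (invol a f) μ := by
  have hm : AEStronglyMeasurable (fun x => (star (a.cocycle x x⁻¹ : 𝓜(ℂ, A))).fst
      (a.act x (star (f x⁻¹)))) μ :=
    ha.cocycle_inv.star.fst_apply (aestronglyMeasurable_aut_apply ha.1
      (continuous_star.comp_aestronglyMeasurable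
        (hf.aestronglyMeasurable.comp_quasiMeasurePreserving (quasiMeasurePreserving_inv μ))))
  refine (integrable_modular_inv_smul_inv μ hf).mono
    (measurable_modular_inv.aestronglyMeasurable.smul hm)
    (Filter.Eventually.of_forall fun x => le_of_eq ?_)
  rw [invol, norm_smul, norm_smul, ← Unitary.coe_star, norm_unitary_fst, norm_aut, norm_star]

end Integrability

theorem conv_invol_eq_integral {G : Type v} [Group G] [TopologicalSpace G] [IsTopologicalGroup G]
    [LocallyCompactSpace G] [SecondCountableTopology G] [MeasurableSpace G] [BorelSpace G]
    (μ : Measure G) [μ.IsHaarMeasure] {A : Type u} [NonUnitalCStarAlgebra A]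
    (a : TwistedAction G A) (f g : G → A) (x : G) :
    conv a μ (invol a f) g x = ∫ y, innerKernel a f g x y ∂μ := by
  rw [conv, ← integral_modular_inv_smul_inv]
  exact integral_congr_ae (Filter.Eventually.of_forall fun y => conv_invol_integrand a f g x y)

/-- Left multiplication by a point mass preserves the inner product `f^⋄ ⋄ g`. -/
theorem conv_invol_deltaLeft {G : Type v} [Group G] [TopologicalSpace G] [IsTopologicalGroup G]
    [LocallyCompactSpace G] [SecondCountableTopology G] [MeasurableSpace G] [BorelSpace G]
    (μ : Measure G) [μ.IsHaarMeasure] {A : Type u} [NonUnitalCStarAlgebra A]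
    (a : TwistedAction G A) (z : G) (m : unitary 𝓜(ℂ, A)) (f g : G → A) :
    conv a μ (invol a (deltaLeft a z m f)) (deltaLeft a z m g) = conv a μ (invol a f) g := by
  funext x
  rw [conv_invol_eq_integral, conv_invol_eq_integral, ← integral_mul_left_eq_self _ z]
  simp only [innerKernel_deltaLeft]

/-! ### Bounded operators on `L¹` given by their action on functions -/

/-- An operation on functions that induces a linear contraction of `L¹`. -/
structure IsLOneOp {G : Type v} [MeasurableSpace G] {A : Type u} [NonUnitalCStarAlgebra A]
    (μ : Measure G) (T : (G → A) → (G → A)) : Prop where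
  integrable : ∀ {f}, Integrable f μ → Integrable (T f) μ
  congr : ∀ {f g}, f =ᵐ[μ] g → T f =ᵐ[μ] T g
  add : ∀ f g, T (f + g) = T f + T g
  smul : ∀ (c : ℂ) f, T (c • f) = c • T f
  norm_le : ∀ {f}, Integrable f μ → ∫ x, ‖T f x‖ ∂μ ≤ ∫ x, ‖f x‖ ∂μ

section LOneOp

variable {G : Type v} [MeasurableSpace G] {A : Type u} [NonUnitalCStarAlgebra A] {μ : Measure G}

/-- The continuous linear map of `L¹` induced by an operation on functions. -/
def IsLOneOp.toCLM {T : (G → A) → (G → A)} (hT : IsLOneOp μ T) : Lp A 1 μ →L[ℂ] Lp A 1 μ :=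
  LinearMap.mkContinuous
    { toFun := fun f => (hT.integrable (L1.integrable_coeFn f)).toL1 _
      map_add' := fun f g => by
        rw [← Integrable.toL1_add, Integrable.toL1_eq_toL1_iff, ← hT.add]
        exact hT.congr (Lp.coeFn_add f g)
      map_smul' := fun c f => by
        rw [RingHom.id_apply, ← Integrable.toL1_smul', Integrable.toL1_eq_toL1_iff, ← hT.smul]
        exact hT.congr (Lp.coeFn_smul c f) } 1 fun f => by
    rw [one_mul, LinearMap.coe_mk, AddHom.coe_mk, L1.norm_eq_integral_norm,
      L1.norm_eq_integral_norm]
    refine le_trans (le_of_eq (integral_congr_ae ?_)) (hT.norm_le (L1.integrable_coeFn f))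
    filter_upwards [(hT.integrable (L1.integrable_coeFn f)).coeFn_toL1] with x hx
    rw [hx]

theorem IsLOneOp.toCLM_coeFn {T : (G → A) → (G → A)} (hT : IsLOneOp μ T) (f : Lp A 1 μ) :
    hT.toCLM f =ᵐ[μ] T f :=
  (hT.integrable (L1.integrable_coeFn f)).coeFn_toL1

theorem IsLOneOp.norm_toCLM_apply_le {T : (G → A) → (G → A)} (hT : IsLOneOp μ T) (f : Lp A 1 μ) :
    ‖hT.toCLM f‖ ≤ ‖f‖ := by
  rw [← one_mul ‖f‖]
  exact (hT.toCLM.le_opNorm f).trans (by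
    gcongr
    exact LinearMap.mkContinuous_norm_le _ zero_le_one _)

theorem IsLOneOp.toCLM_toL1 {T : (G → A) → (G → A)} (hT : IsLOneOp μ T) {f : G → A}
    (hf : Integrable f μ) : hT.toCLM (hf.toL1 f) = (hT.integrable hf).toL1 (T f) := by
  refine Lp.ext ?_
  exact (hT.toCLM_coeFn _).trans ((hT.congr hf.coeFn_toL1).trans (Integrable.coeFn_toL1 _).symm)

theorem IsLOneOp.toCLM_toCLM {T S : (G → A) → (G → A)} (hT : IsLOneOp μ T) (hS : IsLOneOp μ S)
    (h : ∀ f, T (S f) = f) (f : Lp A 1 μ) : hT.toCLM (hS.toCLM f) = f := by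
  refine Lp.ext ((hT.toCLM_coeFn _).trans ((hT.congr (hS.toCLM_coeFn f)).trans ?_))
  rw [h]

/-- A translation followed by a measurable field of isometries of the fibre is an operator
of `L¹`. -/
theorem isLOneOp_of_translation [Group G] [MeasurableMul G] [μ.IsMulLeftInvariant] (z : G)
    (Φ : G → A →L[ℂ] A)
    (hn : ∀ x b, ‖Φ x b‖ = ‖b‖) (hm : ∀ b, AEStronglyMeasurable (fun x => Φ x b) μ)
    {T : (G → A) → (G → A)} (hT : ∀ f x, T f x = Φ x (f (z * x))) : IsLOneOp μ T where
  integrable {f} hf := by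
    have h := hf.comp_mul_left z
    refine h.mono ?_ (Filter.Eventually.of_forall fun x => ?_)
    · rw [show T f = fun x => Φ x (f (z * x)) from funext (hT f)]
      exact aestronglyMeasurable_clm_apply hm h.aestronglyMeasurable
    · rw [hT, hn]
  congr {f g} h := by
    filter_upwards [(measurePreserving_mul_left μ z).quasiMeasurePreserving.ae_eq h] with x hx
    simp only [Function.comp_apply] at hx
    rw [hT, hT, hx]
  add f g := by
    funext x
    simp only [hT, Pi.add_apply, map_add]
  smul c f := by
    funext x
    simp only [hT, Pi.smul_apply, map_smul]
  norm_le {f} _ := by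
    simp only [hT, hn]
    exact (integral_mul_left_eq_self (fun x => ‖f x‖) z).le

end LOneOp

/-! ### The dense image of `L¹` in the crossed product -/

section Dense

variable {G : Type v} [Group G] [TopologicalSpace G] [IsTopologicalGroup G]
  [LocallyCompactSpace G] [MeasurableSpace G]
  {A : Type u} [NonUnitalCStarAlgebra A] (a : TwistedAction G A) (μ : Measure G)

theorem univRep_add (f g : Lp A 1 μ) : univRep a μ (f + g) = univRep a μ f + univRep a μ g :=
  lp.ext (funext fun i => map_add i.toFun f g)

set_option synthInstance.maxHeartbeats 200000 in
theorem univRep_smul (c : ℂ) (f : Lp A 1 μ) : univRep a μ (c • f) = c • univRep a μ f :=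
  lp.ext (funext fun i => map_smul i.toFun c f)

theorem norm_univRep_le (f : Lp A 1 μ) : ‖univRep a μ f‖ ≤ ‖f‖ :=
  lp.norm_le_of_forall_le (norm_nonneg f) fun i => i.norm_le f

/-- The canonical map `L¹(G; A) → A ⋊ G` as a linear map. -/
def toCrossedₗ : Lp A 1 μ →ₗ[ℂ] CrossedProduct a μ where
  toFun := toCrossed a μ
  map_add' f g := Subtype.ext (univRep_add a μ f g)
  map_smul' c f := Subtype.ext (univRep_smul a μ c f)

theorem norm_toCrossed_le (f : Lp A 1 μ) : ‖toCrossed a μ f‖ ≤ ‖f‖ := norm_univRep_le a μ f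

/-- The canonical map `L¹(G; A) → A ⋊ G` as a continuous linear map. -/
def toCrossedL : Lp A 1 μ →L[ℂ] CrossedProduct a μ :=
  (toCrossedₗ a μ).mkContinuous 1 fun f => by rw [one_mul]; exact norm_toCrossed_le a μ f

end Dense

section Represents

variable {G : Type v} [Group G] [TopologicalSpace G] [IsTopologicalGroup G]
  [LocallyCompactSpace G] [MeasurableSpace G]
  {A : Type u} [NonUnitalCStarAlgebra A] {a : TwistedAction G A} {μ : Measure G}

theorem represents_toCrossed (f : Lp A 1 μ) : Represents a μ (toCrossed a μ f) f :=
  ⟨L1.integrable_coeFn f, by rw [Integrable.toL1_coeFn]⟩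

theorem Represents.congr {b : CrossedProduct a μ} {f g : G → A} (h : Represents a μ b f)
    (hfg : f =ᵐ[μ] g) : Represents a μ b g := by
  obtain ⟨hf, rfl⟩ := h
  exact ⟨hf.congr hfg, by rw [(Integrable.toL1_eq_toL1_iff f g hf (hf.congr hfg)).2 hfg]⟩

theorem Represents.unique {b c : CrossedProduct a μ} {f : G → A} (hb : Represents a μ b f)
    (hc : Represents a μ c f) : b = c := by
  obtain ⟨hf, rfl⟩ := hb
  obtain ⟨hf', rfl⟩ := hc
  rfl

theorem Represents.sub {b c : CrossedProduct a μ} {f g : G → A} (hb : Represents a μ b f)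
    (hc : Represents a μ c g) : Represents a μ (b - c) (f - g) := by
  obtain ⟨hf, rfl⟩ := hb
  obtain ⟨hg, rfl⟩ := hc
  exact ⟨hf.sub hg, by
    rw [Integrable.toL1_sub _ _ hf hg]; exact (map_sub (toCrossedₗ a μ) _ _).symm⟩

theorem Represents.norm_le {b : CrossedProduct a μ} {f : G → A} (hb : Represents a μ b f) :
    ‖b‖ ≤ ∫ x, ‖f x‖ ∂μ := by
  obtain ⟨hf, rfl⟩ := hb
  refine (norm_toCrossed_le a μ _).trans (le_of_eq ?_)
  rw [L1.norm_eq_integral_norm]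
  exact integral_congr_ae (hf.coeFn_toL1.mono fun x hx => by simp only [hx])

theorem IsLOneOp.represents_toCLM {T : (G → A) → (G → A)} (hT : IsLOneOp μ T) (f : Lp A 1 μ) :
    Represents a μ (toCrossed a μ (hT.toCLM f)) (T f) :=
  (represents_toCrossed _).congr (hT.toCLM_coeFn f)

variable [SecondCountableTopology G] [BorelSpace G] [μ.IsHaarMeasure]

theorem univRep_conv (ha : a.IsMeasurable μ) (f g : Lp A 1 μ) :
    univRep a μ ((integrable_conv ha (L1.integrable_coeFn f) (L1.integrable_coeFn g)).toL1 _) =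
      univRep a μ f * univRep a μ g :=
  lp.ext (funext fun i => i.map_conv f g _ (Integrable.coeFn_toL1 _))

theorem Represents.mul (ha : a.IsMeasurable μ) {b c : CrossedProduct a μ} {f g : G → A}
    (hb : Represents a μ b f) (hc : Represents a μ c g) :
    Represents a μ (b * c) (conv a μ f g) := by
  obtain ⟨hf, rfl⟩ := hb
  obtain ⟨hg, rfl⟩ := hc
  refine ⟨integrable_conv ha hf hg, Subtype.ext (Eq.trans (univRep_conv ha _ _).symm ?_)⟩
  congr 1
  rw [Integrable.toL1_eq_toL1_iff, conv_congr hf.coeFn_toL1 hg.coeFn_toL1]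

theorem norm_le_of_isLOneOp {T : (G → A) → (G → A)} (hT : IsLOneOp μ T)
    (hconv : ∀ f g, T (conv a μ f g) = conv a μ (T f) (T g))
    (hinv : ∀ f, T (invol a f) = invol a (T f))
    {b c : CrossedProduct a μ} {f : G → A} (hb : Represents a μ b f)
    (hc : Represents a μ c (T f)) : ‖c‖ ≤ ‖b‖ := by
  obtain ⟨hf, rfl⟩ := hb
  obtain ⟨hTf, rfl⟩ := hc
  refine lp.norm_le_of_forall_le (norm_nonneg _) fun i => ?_
  let j : LOneRep a μ :=
    { H := i.H
      toFun := i.toFun.comp hT.toCLM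
      norm_le := fun g => (i.norm_le _).trans (hT.norm_toCLM_apply_le g)
      map_conv := fun f g h hh => i.map_conv _ _ _ <| (hT.toCLM_coeFn h).trans <| by
        change T h =ᵐ[μ] conv a μ (hT.toCLM f) (hT.toCLM g)
        rw [conv_congr (hT.toCLM_coeFn f) (hT.toCLM_coeFn g), ← hconv]
        exact hT.congr hh
      map_invol := fun f h hh => i.map_invol _ _ <| (hT.toCLM_coeFn h).trans <|
        (hT.congr hh).trans <| by
          rw [hinv]
          exact (invol_congr (hT.toCLM_coeFn f)).symm }
  have h := lp.norm_apply_le_norm (by simp) (univRep a μ (hf.toL1 f)) j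
  have h2 : (univRep a μ (hf.toL1 f)) j = i.toFun (hTf.toL1 (T f)) := by
    change i.toFun (hT.toCLM (hf.toL1 f)) = _
    rw [hT.toCLM_toL1 hf]
  rw [h2] at h
  exact h

variable [TopologicalSpace.SeparableSpace A]

theorem univRep_invol (ha : a.IsMeasurable μ) (f : Lp A 1 μ) :
    univRep a μ ((integrable_invol ha (L1.integrable_coeFn f)).toL1 _) = star (univRep a μ f) :=
  lp.ext (funext fun i => i.map_invol f _ (Integrable.coeFn_toL1 _))

theorem Represents.star (ha : a.IsMeasurable μ) {b : CrossedProduct a μ} {f : G → A}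
    (hb : Represents a μ b f) : Represents a μ (star b) (invol a f) := by
  obtain ⟨hf, rfl⟩ := hb
  refine ⟨integrable_invol ha hf, Subtype.ext (Eq.trans (univRep_invol ha _).symm ?_)⟩
  congr 1
  rw [Integrable.toL1_eq_toL1_iff]
  exact invol_congr hf.coeFn_toL1

/-- The image of `L¹(G; A)` is a `⋆`-subalgebra, hence dense in its closure `A ⋊ G`. -/
theorem denseRange_toCrossedₗ (ha : a.IsMeasurable μ) : DenseRange (toCrossedₗ a μ) := by
  let R : NonUnitalStarSubalgebra ℂ (BigAlgebra a μ) :=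
    { carrier := Set.range (univRep a μ)
      add_mem' := by
        rintro _ _ ⟨f, rfl⟩ ⟨g, rfl⟩
        exact ⟨f + g, univRep_add a μ f g⟩
      zero_mem' := ⟨0, lp.ext (funext fun i => map_zero i.toFun)⟩
      smul_mem' := by
        rintro c _ ⟨f, rfl⟩
        exact ⟨c • f, univRep_smul a μ c f⟩
      mul_mem' := by
        rintro _ _ ⟨f, rfl⟩ ⟨g, rfl⟩
        exact ⟨_, univRep_conv ha f g⟩
      star_mem' := by
        rintro _ ⟨f, rfl⟩
        exact ⟨_, univRep_invol ha f⟩ }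
  have hR : NonUnitalStarAlgebra.adjoin ℂ (Set.range (univRep a μ)) ≤ R :=
    NonUnitalStarAlgebra.adjoin_le (fun _ h => h)
  intro b
  have hb : (b.1 : BigAlgebra a μ) ∈ closure (Set.range (univRep a μ)) :=
    closure_mono hR b.2
  refine Metric.mem_closure_iff.2 fun ε hε => ?_
  obtain ⟨_, ⟨f, rfl⟩, hf⟩ := Metric.mem_closure_iff.1 hb ε hε
  exact ⟨_, ⟨f, rfl⟩, hf⟩

/-- A closed condition holds on the crossed product if it holds on the image of `L¹`. -/
theorem crossedProduct_induction (ha : a.IsMeasurable μ) {p : CrossedProduct a μ → Prop}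
    (hc : IsClosed {b | p b}) (h : ∀ b f, Represents a μ b f → p b) (b : CrossedProduct a μ) :
    p b :=
  (denseRange_toCrossedₗ ha).induction_on b hc fun f => h _ _ (represents_toCrossed f)

theorem separableSpace_crossedProduct (ha : a.IsMeasurable μ) :
    TopologicalSpace.SeparableSpace (CrossedProduct a μ) := by
  have : Fact ((1 : ℝ≥0∞) ≠ ∞) := ⟨ENNReal.one_ne_top⟩
  exact (denseRange_toCrossedₗ ha).separableSpace (toCrossedL a μ).continuous

/-- Continuous maps out of the crossed product are determined on the image of `L¹`. -/
theorem crossedProduct_eq_of_continuous {E : Type*} [TopologicalSpace E] [T2Space E]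
    (ha : a.IsMeasurable μ) {F F' : CrossedProduct a μ → E} (hF : Continuous F)
    (hF' : Continuous F') (h : ∀ b f, Represents a μ b f → F b = F' b) (b : CrossedProduct a μ) :
    F b = F' b :=
  crossedProduct_induction ha (isClosed_eq hF hF') h b

/-! ### Extension of operators from `L¹` to the crossed product -/

/-- Mutually inverse operators on `L¹` that preserve the enveloping norm extend to the crossed
product. -/
theorem exists_linearIsometryEquiv (ha : a.IsMeasurable μ) {T S : (G → A) → (G → A)}
    (hT : IsLOneOp μ T) (hS : IsLOneOp μ S) (hTS : ∀ f, T (S f) = f) (hST : ∀ f, S (T f) = f)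
    (hn : ∀ b c f, Represents a μ b f → Represents a μ c (T f) → ‖c‖ = ‖b‖) :
    ∃ V : CrossedProduct a μ ≃ₗᵢ[ℂ] CrossedProduct a μ,
      (∀ b f, Represents a μ b f → Represents a μ (V b) (T f)) ∧
      (∀ b f, Represents a μ b f → Represents a μ (V.symm b) (S f)) := by
  let e : Lp A 1 μ ≃ₗ[ℂ] Lp A 1 μ :=
    { hT.toCLM.toLinearMap with
      invFun := hS.toCLM
      left_inv := hS.toCLM_toCLM hT hST
      right_inv := hT.toCLM_toCLM hS hTS }
  have hd := denseRange_toCrossedₗ ha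
  have hne : ∀ f, ‖toCrossedₗ a μ (e f)‖ = ‖toCrossedₗ a μ f‖ := fun f =>
    hn _ _ f (represents_toCrossed f) (hT.represents_toCLM f)
  refine ⟨e.extendOfIsometry (toCrossedₗ a μ) (toCrossedₗ a μ) hd hd hne, ?_, ?_⟩
  · rintro b f ⟨hf, rfl⟩
    refine ⟨hT.integrable hf, ?_⟩
    rw [← hT.toCLM_toL1 hf]
    exact e.extendOfIsometry_eq _ _ hd hd hne _
  · rintro b f ⟨hf, rfl⟩
    refine ⟨hS.integrable hf, ?_⟩
    rw [← hS.toCLM_toL1 hf]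
    exact e.extendOfIsometry_symm_eq _ _ hd hd hne _

/-- Invertible operators on `L¹` that preserve the inner product `f^⋄ ⋄ g` extend to unitary
multipliers of the crossed product. -/
theorem exists_unitary_of_inner (ha : a.IsMeasurable μ) {T S : (G → A) → (G → A)}
    (hT : IsLOneOp μ T) (hS : IsLOneOp μ S) (hTS : ∀ f, T (S f) = f) (hST : ∀ f, S (T f) = f)
    (hin : ∀ f g, conv a μ (invol a (T f)) (T g) = conv a μ (invol a f) g) :
    ∃ U : unitary 𝓜(ℂ, CrossedProduct a μ), ∀ b f, Represents a μ b f →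
      Represents a μ ((U : 𝓜(ℂ, CrossedProduct a μ)).fst b) (T f) ∧
        Represents a μ ((U : 𝓜(ℂ, CrossedProduct a μ)).snd b) (invol a (S (invol a f))) := by
  obtain ⟨V, hV, hV'⟩ := exists_linearIsometryEquiv ha hT hS hTS hST fun b c f hb hc => by
    have h := ((hc.star ha).mul ha hc)
    rw [hin] at h
    have h2 : ‖c‖ * ‖c‖ = ‖b‖ * ‖b‖ := by
      rw [← CStarRing.norm_star_mul_self, ← CStarRing.norm_star_mul_self,
        h.unique ((hb.star ha).mul ha hb)]
    exact (mul_self_inj (norm_nonneg _) (norm_nonneg _)).1 h2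
  have hVin : ∀ b c, star (V b) * V c = star b * c := by
    intro b c
    refine crossedProduct_eq_of_continuous ha (F := fun b => star (V b) * V c)
      (F' := fun b => star b * c) (by fun_prop) (by fun_prop) (fun b f hb => ?_) b
    refine crossedProduct_eq_of_continuous ha (F := fun c => star (V b) * V c)
      (F' := fun c => star b * c) (by fun_prop) (by fun_prop) (fun c g hc => ?_) c
    have h := ((hV b f hb).star ha).mul ha (hV c g hc)
    rw [hin] at h
    exact h.unique ((hb.star ha).mul ha hc)
  let st : CrossedProduct a μ →L⋆[ℂ] CrossedProduct a μ :=
    ((starₗᵢ ℂ : CrossedProduct a μ ≃ₗᵢ⋆[ℂ] CrossedProduct a μ) :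
      CrossedProduct a μ →L⋆[ℂ] CrossedProduct a μ)
  let U : 𝓜(ℂ, CrossedProduct a μ) :=
    { fst := (V.toContinuousLinearEquiv : CrossedProduct a μ →L[ℂ] CrossedProduct a μ)
      snd := (st.comp
        (V.symm.toContinuousLinearEquiv : CrossedProduct a μ →L[ℂ] CrossedProduct a μ)).comp st
      central := fun b c => by
        change star (V.symm (star b)) * c = b * V c
        rw [← hVin, V.apply_symm_apply, star_star] }
  have hfst : ∀ b, U.fst b = V b := fun _ => rfl
  have hsnd : ∀ b, U.snd b = star (V.symm (star b)) := fun _ => rfl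
  refine ⟨⟨U, Unitary.mem_iff.2 ⟨multiplier_ext fun b => ?_, multiplier_ext fun b => ?_⟩⟩,
    fun b f hb => ⟨hV b f hb, (hV' _ _ (hb.star ha)).star ha⟩⟩
  · change (star U).fst (U.fst b) = b
    rw [DoubleCentralizer.star_fst, hfst, hsnd, star_star, star_star, V.symm_apply_apply]
  · change U.fst ((star U).fst b) = b
    rw [DoubleCentralizer.star_fst, hfst, hsnd, star_star, star_star, V.apply_symm_apply]

/-- A `⋆`-automorphism of `L¹` extends to the crossed product: it permutes the representations of
`L¹`, so that it preserves the enveloping norm. -/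
theorem exists_automorphism (ha : a.IsMeasurable μ) {T S : (G → A) → (G → A)}
    (hT : IsLOneOp μ T) (hS : IsLOneOp μ S) (hTS : ∀ f, T (S f) = f) (hST : ∀ f, S (T f) = f)
    (hconv : ∀ f g, T (conv a μ f g) = conv a μ (T f) (T g))
    (hinv : ∀ f, T (invol a f) = invol a (T f)) :
    ∃ φ : CrossedProduct a μ ≃⋆ₐ[ℂ] CrossedProduct a μ,
      ∀ b f, Represents a μ b f → Represents a μ (φ b) (T f) := by
  have hconv' : ∀ f g, S (conv a μ f g) = conv a μ (S f) (S g) := fun f g => by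
    rw [← hST (conv a μ (S f) (S g)), hconv, hTS, hTS]
  have hinv' : ∀ f, S (invol a f) = invol a (S f) := fun f => by
    rw [← hST (invol a (S f)), hinv, hTS]
  obtain ⟨V, hV, -⟩ := exists_linearIsometryEquiv ha hT hS hTS hST fun b c f hb hc =>
    le_antisymm (norm_le_of_isLOneOp hT hconv hinv hb hc)
      (norm_le_of_isLOneOp hS hconv' hinv' hc ((hST f).symm ▸ hb))
  refine ⟨{ V with
    map_mul' := fun b c => ?_
    map_star' := fun b => ?_
    map_smul' := fun c b => map_smul V c b }, hV⟩
  · change V (b * c) = V b * V c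
    refine crossedProduct_eq_of_continuous ha (F := fun b => V (b * c))
      (F' := fun b => V b * V c) (by fun_prop) (by fun_prop) (fun b f hb => ?_) b
    refine crossedProduct_eq_of_continuous ha (F := fun c => V (b * c))
      (F' := fun c => V b * V c) (by fun_prop) (by fun_prop) (fun c g hc => ?_) c
    have h := hV _ _ (hb.mul ha hc)
    rw [hconv] at h
    exact h.unique ((hV b f hb).mul ha (hV c g hc))
  · change V (star b) = star (V b)
    refine crossedProduct_eq_of_continuous ha (F := fun b => V (star b))
      (F' := fun b => star (V b)) (by fun_prop) (by fun_prop) (fun b f hb => ?_) b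
    have h := hV _ _ (hb.star ha)
    rw [hinv] at h
    exact h.unique ((hV b f hb).star ha)

end Represents

/-! ### Strictly continuous and measurable families of unitary multipliers -/

section StrictUnitary

variable {B : Type u} [NonUnitalCStarAlgebra B]

theorem unitary_snd_eq (U : unitary 𝓜(ℂ, B)) (b : B) :
    (U : 𝓜(ℂ, B)).snd b = star ((star U : unitary 𝓜(ℂ, B)).1.fst (star b)) := by
  rw [Unitary.coe_star, DoubleCentralizer.star_fst, star_star, star_star]

theorem dist_star_unitary_fst (U : unitary 𝓜(ℂ, B)) (b c : B) :
    dist ((star U : unitary 𝓜(ℂ, B)).1.fst b) c = dist ((U : 𝓜(ℂ, B)).fst c) b := by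
  have h : (U : 𝓜(ℂ, B)).fst ((star U : unitary 𝓜(ℂ, B)).1.fst b) = b := by
    change ((U : 𝓜(ℂ, B)) * (star U : unitary 𝓜(ℂ, B)).1).fst b = b
    rw [Unitary.coe_star, unitary_mul_star]
    rfl
  rw [dist_comm, dist_eq_norm, ← norm_unitary_fst U, map_sub, h, dist_eq_norm]

/-- For unitary multipliers, strict measurability can be tested on left multiplications: the
adjoint satisfies `‖U⋆ b - c‖ = ‖U c - b‖`. -/
theorem strictMeasurable_of_fst [TopologicalSpace.SeparableSpace B] {X : Type*} [MeasurableSpace X]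
    {μ : Measure X} {U : X → unitary 𝓜(ℂ, B)}
    (h : ∀ b, AEStronglyMeasurable (fun t => (U t : 𝓜(ℂ, B)).fst b) μ) :
    StrictMeasurable (fun t => (U t : 𝓜(ℂ, B))) μ := by
  refine fun b => ⟨h b, ?_⟩
  simp only [unitary_snd_eq]
  refine continuous_star.comp_aestronglyMeasurable (aestronglyMeasurable_of_dist fun c => ?_)
  simp only [dist_star_unitary_fst]
  exact (h c).dist aestronglyMeasurable_const

theorem strictContinuous_of_fst {X : Type*} [TopologicalSpace X] {U : X → unitary 𝓜(ℂ, B)}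
    (h : ∀ b, Continuous (fun t => (U t : 𝓜(ℂ, B)).fst b)) :
    StrictContinuous (fun t => (U t : 𝓜(ℂ, B))) := by
  refine fun b => ⟨h b, ?_⟩
  simp only [unitary_snd_eq]
  refine continuous_star.comp (continuous_iff_continuousAt.2 fun s => ?_)
  refine tendsto_iff_dist_tendsto_zero.2 ?_
  simp only [dist_star_unitary_fst]
  have h1 := ((h ((star (U s) : unitary 𝓜(ℂ, B)).1.fst (star b))).dist
    (continuous_const (y := star b))).tendsto s
  rwa [← dist_star_unitary_fst, dist_self] at h1

/-- A pointwise continuous family of linear isometries may be applied to a continuous function. -/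
theorem continuous_isometry_apply {X : Type*} [TopologicalSpace X] {E : Type*}
    [NormedAddCommGroup E] [NormedSpace ℂ E] {Φ : X → E →L[ℂ] E} (hn : ∀ t b, ‖Φ t b‖ = ‖b‖)
    (hc : ∀ b, Continuous (fun t => Φ t b)) {f : X → E} (hf : Continuous f) :
    Continuous (fun t => Φ t (f t)) := by
  refine continuous_iff_continuousAt.2 fun s => ?_
  have h1 : Filter.Tendsto (fun t => Φ t (f t - f s)) (𝓝 s) (𝓝 0) := by
    rw [tendsto_zero_iff_norm_tendsto_zero]
    simp only [hn]
    have := ((hf.sub (continuous_const (y := f s))).norm).tendsto s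
    simpa using this
  have h2 := h1.add ((hc (f s)).tendsto s)
  simp only [map_sub, sub_add_cancel, zero_add] at h2
  exact h2

theorem StrictContinuous.fst_apply {X : Type*} [TopologicalSpace X] {U : X → unitary 𝓜(ℂ, B)}
    (hU : StrictContinuous (fun t => (U t : 𝓜(ℂ, B)))) {f : X → B} (hf : Continuous f) :
    Continuous (fun t => (U t : 𝓜(ℂ, B)).fst (f t)) :=
  continuous_isometry_apply (fun t b => norm_unitary_fst (U t) b) (fun b => (hU b).1) hf

theorem StrictContinuous.snd_apply {X : Type*} [TopologicalSpace X] {U : X → unitary 𝓜(ℂ, B)}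
    (hU : StrictContinuous (fun t => (U t : 𝓜(ℂ, B)))) {f : X → B} (hf : Continuous f) :
    Continuous (fun t => (U t : 𝓜(ℂ, B)).snd (f t)) :=
  continuous_isometry_apply (fun t b => norm_unitary_snd (U t) b) (fun b => (hU b).2) hf

theorem continuous_aut_apply {X : Type*} [TopologicalSpace X] {φ : X → B ≃⋆ₐ[ℂ] B}
    (hφ : ∀ b, Continuous (fun x => φ x b)) {f : X → B} (hf : Continuous f) :
    Continuous (fun x => φ x (f x)) :=
  continuous_isometry_apply (Φ := fun x => autCLM (φ x)) (fun x b => norm_aut (φ x) b) hφ hf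

theorem StrictContinuous.star {X : Type*} [TopologicalSpace X] {U : X → unitary 𝓜(ℂ, B)}
    (hU : StrictContinuous (fun t => (U t : 𝓜(ℂ, B)))) :
    StrictContinuous (fun t => ((star (U t) : unitary 𝓜(ℂ, B)) : 𝓜(ℂ, B))) :=
  fun b => ⟨continuous_star.comp (hU (Star.star b)).2, continuous_star.comp (hU (Star.star b)).1⟩

theorem StrictContinuous.strictMeasurable {X : Type*} [TopologicalSpace X] [MeasurableSpace X]
    [OpensMeasurableSpace X] [SecondCountableTopology X] {μ : Measure X} {m : X → 𝓜(ℂ, B)}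
    (hm : StrictContinuous m) : StrictMeasurable m μ :=
  fun b => ⟨(hm b).1.aestronglyMeasurable, (hm b).2.aestronglyMeasurable⟩

theorem isClosed_setOf_aestronglyMeasurable {X : Type*} [MeasurableSpace X] {μ : Measure X}
    (Φ : X → B →L[ℂ] B) : IsClosed {b | AEStronglyMeasurable (fun t => Φ t b) μ} := by
  refine isClosed_of_closure_subset fun b hb => ?_
  obtain ⟨s, hs, hsb⟩ := mem_closure_iff_seq_limit.1 hb
  exact aestronglyMeasurable_of_tendsto_ae Filter.atTop hs
    (Filter.Eventually.of_forall fun t => ((Φ t).continuous.tendsto b).comp hsb)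

theorem isClosed_setOf_continuous {X : Type*} [TopologicalSpace X] {Φ : X → B →L[ℂ] B}
    (hn : ∀ t b, ‖Φ t b‖ = ‖b‖) : IsClosed {b | Continuous (fun t => Φ t b)} := by
  refine isClosed_of_closure_subset fun b hb => ?_
  refine continuous_of_uniform_approx_of_continuous fun u hu => ?_
  obtain ⟨ε, hε, hεu⟩ := Metric.mem_uniformity_dist.1 hu
  obtain ⟨c, hc, hbc⟩ := Metric.mem_closure_iff.1 hb ε hε
  refine ⟨fun t => Φ t c, hc, fun t => hεu ?_⟩
  rwa [dist_eq_norm, ← map_sub, hn, ← dist_eq_norm]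

end StrictUnitary

/-! ### Measurable and continuous families in the crossed product -/

section Families

variable {G : Type v} [Group G] [TopologicalSpace G] [IsTopologicalGroup G]
  [LocallyCompactSpace G] [MeasurableSpace G] {μ : Measure G}
  {A : Type u} [NonUnitalCStarAlgebra A] {a : TwistedAction G A}

theorem continuousAt_of_represents {X : Type*} [TopologicalSpace X] [FirstCountableTopology X]
    {u : X → CrossedProduct a μ} {F : X → G → A} (hr : ∀ t, Represents a μ (u t) (F t)) {s : X}
    {bound : G → ℝ} (hbi : Integrable bound μ) (hb : ∀ᶠ t in 𝓝 s, ∀ x, ‖F t x‖ ≤ bound x)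
    (hc : ∀ x, ContinuousAt (fun t => F t x) s) : ContinuousAt u s := by
  have hlim : Filter.Tendsto (fun t => ∫ x, ‖F t x - F s x‖ ∂μ) (𝓝 s) (𝓝 (∫ _, (0 : ℝ) ∂μ)) := by
    refine tendsto_integral_filter_of_dominated_convergence (fun x => bound x + bound x)
      (Filter.Eventually.of_forall fun t =>
        ((hr t).1.sub (hr s).1).norm.aestronglyMeasurable) ?_ (hbi.add hbi)
      (Filter.Eventually.of_forall fun x => ?_)
    · filter_upwards [hb] with t ht
      refine Filter.Eventually.of_forall fun x => ?_
      rw [norm_norm]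
      exact (norm_sub_le _ _).trans (add_le_add (ht x) (hb.self_of_nhds x))
    · simpa using ((hc x).sub (continuousAt_const (y := F s x))).norm.tendsto
  rw [integral_zero] at hlim
  refine tendsto_iff_dist_tendsto_zero.2 (squeeze_zero (fun t => dist_nonneg) (fun t => ?_) hlim)
  rw [dist_eq_norm]
  exact ((hr t).sub (hr s)).norm_le

theorem continuous_of_represents {X : Type*} [TopologicalSpace X] [FirstCountableTopology X]
    {u : X → CrossedProduct a μ} {F : X → G → A} (hr : ∀ t, Represents a μ (u t) (F t))
    {bound : G → ℝ} (hbi : Integrable bound μ) (hb : ∀ t x, ‖F t x‖ ≤ bound x)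
    (hc : ∀ x, Continuous (fun t => F t x)) : Continuous u :=
  continuous_iff_continuousAt.2 fun _ => continuousAt_of_represents hr hbi
    (Filter.Eventually.of_forall hb) fun x => (hc x).continuousAt

variable [SecondCountableTopology G] [BorelSpace G] [μ.IsHaarMeasure]
  [TopologicalSpace.SeparableSpace A]

theorem aestronglyMeasurable_of_represents {X : Type*} [MeasurableSpace X] {μX : Measure X}
    {u : X → CrossedProduct a μ} {F : X → G → A} (hr : ∀ t, Represents a μ (u t) (F t))
    (hF : AEStronglyMeasurable (fun p : X × G => F p.1 p.2) (μX.prod μ)) :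
    AEStronglyMeasurable u μX := by
  choose hi hu using hr
  rw [show u = fun t => toCrossedL a μ ((hi t).toL1 (F t)) from funext hu]
  exact (toCrossedL a μ).continuous.comp_aestronglyMeasurable (aestronglyMeasurable_toL1 hF hi)

/-! ### Point masses as multipliers of the crossed product -/

theorem isLOneOp_deltaLeft (ha : a.IsMeasurable μ) (z : G) (m : unitary 𝓜(ℂ, A)) :
    IsLOneOp μ (deltaLeft a z m) :=
  isLOneOp_of_translation z⁻¹ (fun x => (m : 𝓜(ℂ, A)).fst.comp
      ((a.cocycle z (z⁻¹ * x) : 𝓜(ℂ, A)).snd.comp (autCLM (a.act z))))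
    (fun x b => by
      change ‖(m : 𝓜(ℂ, A)).fst ((a.cocycle z (z⁻¹ * x) : 𝓜(ℂ, A)).snd (a.act z b))‖ = _
      rw [norm_unitary_fst, norm_unitary_snd, norm_aut])
    (fun b => (m : 𝓜(ℂ, A)).fst.continuous.comp_aestronglyMeasurable
      (((ha.cocycle_left z).comp
        (measurePreserving_mul_left μ z⁻¹).quasiMeasurePreserving) (a.act z b)).2)
    (fun _ _ => rfl)

theorem isLOneOp_deltaLeftSymm (ha : a.IsMeasurable μ) (z : G) (m : unitary 𝓜(ℂ, A)) :
    IsLOneOp μ (deltaLeftSymm a z m) :=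
  isLOneOp_of_translation z (fun x => (autCLM (a.act z).symm).comp
      ((star m : unitary 𝓜(ℂ, A)).1.fst.comp
        (star (a.cocycle z x) : unitary 𝓜(ℂ, A)).1.snd))
    (fun x b => by
      change ‖(a.act z).symm ((star m : unitary 𝓜(ℂ, A)).1.fst
        ((star (a.cocycle z x) : unitary 𝓜(ℂ, A)).1.snd b))‖ = _
      rw [norm_aut, norm_unitary_fst, norm_unitary_snd])
    (fun b => ((autCLM (a.act z).symm).comp
        (star m : unitary 𝓜(ℂ, A)).1.fst).continuous.comp_aestronglyMeasurable
      ((ha.cocycle_left z).star b).2)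
    (fun _ _ => rfl)

theorem exists_isDelta (ha : a.IsMeasurable μ) (z : G) (m : unitary 𝓜(ℂ, A)) :
    ∃ U : unitary 𝓜(ℂ, CrossedProduct a μ),
      IsDelta a μ z m (U : 𝓜(ℂ, CrossedProduct a μ)) := by
  obtain ⟨U, hU⟩ := exists_unitary_of_inner ha (isLOneOp_deltaLeft ha z m)
    (isLOneOp_deltaLeftSymm ha z m) (deltaLeft_deltaLeftSymm a z m) (deltaLeftSymm_deltaLeft a z m)
    (conv_invol_deltaLeft μ a z m)
  refine ⟨U, fun f b hb => ⟨(hU b f hb).1, ?_⟩⟩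
  rw [← invol_deltaLeftSymm_invol]
  exact (hU b f hb).2

/-- Multipliers of the crossed product are determined by their left action on `L¹`. -/
theorem multiplier_eq_of_represents (ha : a.IsMeasurable μ) {M N : 𝓜(ℂ, CrossedProduct a μ)}
    (h : ∀ b f, Represents a μ b f → ∃ g, Represents a μ (M.fst b) g ∧ Represents a μ (N.fst b) g) :
    M = N :=
  multiplier_ext fun b => crossedProduct_eq_of_continuous ha (F := M.fst) (F' := N.fst)
    M.fst.continuous N.fst.continuous (fun b f hb => by
      obtain ⟨g, h1, h2⟩ := h b f hb
      exact h1.unique h2) b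

theorem IsDelta.eq_one (ha : a.IsMeasurable μ) {M : 𝓜(ℂ, CrossedProduct a μ)}
    (hM : IsDelta a μ 1 1 M) : M = 1 :=
  multiplier_eq_of_represents ha fun b f hb => ⟨f, by
    have h := (hM f b hb).1
    rwa [deltaLeft_one_one] at h, hb⟩

/-- `(δ_e ⊗ m) ⋄ (δ_z ⊗ n) = δ_z ⊗ m n`. -/
theorem IsDelta.mul_eq (ha : a.IsMeasurable μ) {z : G} {m n : 𝓜(ℂ, A)}
    {M N K : 𝓜(ℂ, CrossedProduct a μ)} (hM : IsDelta a μ 1 m M) (hN : IsDelta a μ z n N)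
    (hK : IsDelta a μ z (m * n) K) : M * N = K :=
  multiplier_eq_of_represents ha fun b f hb => ⟨_, (hM _ _ (hN f b hb).1).1, by
    rw [deltaLeft_one_deltaLeft]
    exact (hK f b hb).1⟩

/-- `(δ_y ⊗ 1) ⋄ (δ_z ⊗ 1) = (δ_e ⊗ α(y, z)) ⋄ (δ_{yz} ⊗ 1)`. -/
theorem IsDelta.mul_eq_mul (ha : a.IsMeasurable μ) {y z : G}
    {M N K L : 𝓜(ℂ, CrossedProduct a μ)} (hM : IsDelta a μ y 1 M) (hN : IsDelta a μ z 1 N)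
    (hK : IsDelta a μ 1 (a.cocycle y z) K) (hL : IsDelta a μ (y * z) 1 L) : M * N = K * L :=
  multiplier_eq_of_represents ha fun b f hb => ⟨_, (hM _ _ (hN f b hb).1).1, by
    have h := (hK _ _ (hL f b hb).1).1
    rwa [deltaLeft_one_deltaLeft, mul_one, ← deltaLeft_deltaLeft_one] at h⟩

theorem strictMeasurable_of_isDelta_one (ha : a.IsMeasurable μ) {X : Type*} [MeasurableSpace X]
    {μX : Measure X} [SFinite μX] {m : X → unitary 𝓜(ℂ, A)}
    (hm : StrictMeasurable (fun t => (m t : 𝓜(ℂ, A))) μX)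
    {U : X → unitary 𝓜(ℂ, CrossedProduct a μ)}
    (hU : ∀ t, IsDelta a μ 1 (m t) (U t : 𝓜(ℂ, CrossedProduct a μ))) :
    StrictMeasurable (fun t => (U t : 𝓜(ℂ, CrossedProduct a μ))) μX := by
  have := separableSpace_crossedProduct ha
  refine strictMeasurable_of_fst (crossedProduct_induction ha
    (isClosed_setOf_aestronglyMeasurable fun t => (U t : 𝓜(ℂ, CrossedProduct a μ)).fst) ?_)
  intro b f hb
  refine aestronglyMeasurable_of_represents (fun t => (hU t f b hb).1) ?_
  simp only [deltaLeft_one_apply]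
  exact (hm.comp Measure.quasiMeasurePreserving_fst).fst_apply hb.1.aestronglyMeasurable.comp_snd

theorem strictContinuous_of_isDelta_one (ha : a.IsMeasurable μ) {X : Type*} [TopologicalSpace X]
    [FirstCountableTopology X] {m : X → unitary 𝓜(ℂ, A)}
    (hm : StrictContinuous (fun t => (m t : 𝓜(ℂ, A))))
    {U : X → unitary 𝓜(ℂ, CrossedProduct a μ)}
    (hU : ∀ t, IsDelta a μ 1 (m t) (U t : 𝓜(ℂ, CrossedProduct a μ))) :
    StrictContinuous (fun t => (U t : 𝓜(ℂ, CrossedProduct a μ))) := by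
  refine strictContinuous_of_fst (crossedProduct_induction ha
    (isClosed_setOf_continuous fun t => norm_unitary_fst (U t)) ?_)
  intro b f hb
  refine continuous_of_represents (fun t => (hU t f b hb).1) hb.1.norm (fun t x => ?_) fun x => ?_
  · rw [deltaLeft_one_apply, norm_unitary_fst]
  · simp only [deltaLeft_one_apply]
    exact (hm (f x)).1

theorem strictMeasurable_of_isDelta_unit (ha : a.IsMeasurable μ)
    {U : G → unitary 𝓜(ℂ, CrossedProduct a μ)}
    (hU : ∀ z, IsDelta a μ z 1 (U z : 𝓜(ℂ, CrossedProduct a μ))) :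
    StrictMeasurable (fun z => (U z : 𝓜(ℂ, CrossedProduct a μ))) μ := by
  have := separableSpace_crossedProduct ha
  refine strictMeasurable_of_fst (crossedProduct_induction ha
    (isClosed_setOf_aestronglyMeasurable fun t => (U t : 𝓜(ℂ, CrossedProduct a μ)).fst) ?_)
  intro b f hb
  refine aestronglyMeasurable_of_represents (fun t => (hU t f b hb).1) ?_
  have hτ := measurePreserving_prod_inv_mul μ μ
  refine AEStronglyMeasurable.comp_measurePreserving (ν := μ.prod μ)
    (g := fun p : G × G => (a.cocycle p.1 p.2 : 𝓜(ℂ, A)).snd (a.act p.1 (f p.2))) ?_ hτ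
  exact ha.2.snd_apply (aestronglyMeasurable_aut_apply (φ := fun p : G × G => a.act p.1)
    (fun b => (ha.1 b).comp_fst) hb.1.aestronglyMeasurable.comp_snd)

open scoped Pointwise in
/-- The elements represented by continuous compactly supported functions are dense; for such a
function, dominated convergence applies near each point, with a compactly supported bound. -/
theorem strictContinuous_of_isDelta_unit (ha : a.IsMeasurable μ) (hac : a.IsContinuous)
    {U : G → unitary 𝓜(ℂ, CrossedProduct a μ)}
    (hU : ∀ z, IsDelta a μ z 1 (U z : 𝓜(ℂ, CrossedProduct a μ))) :
    StrictContinuous (fun z => (U z : 𝓜(ℂ, CrossedProduct a μ))) := by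
  have hcl := isClosed_setOf_continuous
    (Φ := fun z => (U z : 𝓜(ℂ, CrossedProduct a μ)).fst) fun t => norm_unitary_fst (U t)
  have hcs : ∀ b f, Represents a μ b f → Continuous f → HasCompactSupport f →
      Continuous (fun z => (U z : 𝓜(ℂ, CrossedProduct a μ)).fst b) := by
    intro b f hb hf hfs
    refine continuous_iff_continuousAt.2 fun s => ?_
    obtain ⟨K, hK, hKs⟩ := exists_compact_mem_nhds s
    obtain ⟨C, hC⟩ := hf.bounded_above_of_compact_support hfs
    have hKf : IsCompact (closure (K * tsupport f)) := (hK.mul hfs.isCompact).closure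
    have hn : ∀ z x, ‖deltaLeft a z 1 f x‖ = ‖f (z⁻¹ * x)‖ := fun z x => by
      change ‖(a.cocycle z (z⁻¹ * x) : 𝓜(ℂ, A)).snd (a.act z (f (z⁻¹ * x)))‖ = _
      rw [norm_unitary_snd, norm_aut]
    refine continuousAt_of_represents (fun t => (hU t f b hb).1)
      (bound := (closure (K * tsupport f)).indicator fun _ => C)
      ((integrable_indicator_iff isClosed_closure.measurableSet).2
        (integrableOn_const hKf.measure_lt_top.ne)) ?_ fun x => ?_
    · filter_upwards [hKs] with z hz x
      rw [hn]
      by_cases hx : z⁻¹ * x ∈ tsupport f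
      · rw [Set.indicator_of_mem]
        · exact hC _
        · exact subset_closure ⟨z, hz, _, hx, mul_inv_cancel_left z x⟩
      · rw [image_eq_zero_of_notMem_tsupport hx, norm_zero]
        exact Set.indicator_nonneg (fun _ _ => (norm_nonneg _).trans (hC 1)) x
    · refine Continuous.continuousAt ?_
      have h1 : Continuous fun z : G => (z, z⁻¹ * x) := by fun_prop
      exact StrictContinuous.snd_apply (U := fun z => a.cocycle z (z⁻¹ * x))
        (fun b => ⟨((hac.2 b).1).comp h1, ((hac.2 b).2).comp h1⟩)
        (continuous_aut_apply hac.1 (hf.comp (continuous_snd.comp h1)))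
  refine strictContinuous_of_fst (crossedProduct_induction ha hcl fun b f hb => ?_)
  refine hcl.closure_subset (Metric.mem_closure_iff.2 fun ε hε => ?_)
  obtain ⟨g, hgs, hfg, hgc, hgi⟩ := hb.1.exists_hasCompactSupport_integral_sub_le (half_pos hε)
  refine ⟨_, hcs _ g ⟨hgi, rfl⟩ hgc hgs, ?_⟩
  rw [dist_eq_norm]
  exact ((hb.sub ⟨hgi, rfl⟩).norm_le.trans hfg).trans_lt (half_lt_self hε)

end Families

/-! ### Particular covariant structures from cochains -/

section Particular

variable {G : Type v} {Γ : Type w} [Group G] {B : Type u} [NonUnitalCStarAlgebra B]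

/-- The inner twisted action `(ad_ρ, ρ_ξ ρ_η ρ_{ξη}⋆)` of a unitary `1`-cochain `ρ`. -/
def innerTwistedAction [Group Γ] (ρ : Γ → unitary 𝓜(ℂ, B)) (h1 : ρ 1 = 1) : TwistedAction Γ B where
  act ξ := adEquiv (ρ ξ)
  cocycle ξ η := ρ ξ * ρ η * star (ρ (ξ * η))
  act_one b := coe_injective <| by
    change ((ad (ρ 1) b : B) : 𝓜(ℂ, B)) = _
    rw [coe_ad, h1, OneMemClass.coe_one, star_one, one_mul, mul_one]
  act_act ξ η b := coe_injective <| by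
    change ((ad (ρ ξ) (ad (ρ η) b) : B) : 𝓜(ℂ, B)) =
      ((ad (ρ ξ * ρ η * star (ρ (ξ * η))) (ad (ρ (ξ * η)) b) : B) : 𝓜(ℂ, B))
    rw [coe_ad, coe_ad, coe_ad, coe_ad]
    simp only [Submonoid.coe_mul, Unitary.coe_star, star_mul, star_star, mul_assoc,
      unitary_star_mul_cancel]
  cocycle_one_right ξ := by rw [mul_one, h1, mul_one, Unitary.mul_star_self]
  cocycle_one_left ξ := by rw [one_mul, h1, one_mul, Unitary.mul_star_self]
  cocycle_mul ξ η ζ := by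
    rw [extendMul_adEquiv]
    simp only [Submonoid.coe_mul, Unitary.coe_star, mul_assoc, unitary_star_mul_cancel]

variable {c : TwistedAction G B} {ρ : Γ → unitary 𝓜(ℂ, B)} {k : G → Γ → unitary 𝓜(ℂ, B)}

theorem particular_commutation
    (h : ∀ x ξ, extendMul (c.act x) (ρ ξ) = (k x ξ : 𝓜(ℂ, B)) * ρ ξ) (x : G) (ξ : Γ) (b : B) :
    c.act x (adEquiv (ρ ξ) b) = ad (k x ξ) (adEquiv (ρ ξ) (c.act x b)) := coe_injective <| by
  change ((c.act x (ad (ρ ξ) b) : B) : 𝓜(ℂ, B)) =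
    ((ad (k x ξ) (ad (ρ ξ) (c.act x b)) : B) : 𝓜(ℂ, B))
  rw [coe_aut, coe_ad, coe_ad, coe_ad, coe_aut, extendMul_mul, extendMul_mul, extendMul_star, h,
    star_mul]
  simp only [mul_assoc]

theorem particular_act_tilde_cocycle [Group Γ]
    (h : ∀ x ξ, extendMul (c.act x) (ρ ξ) = (k x ξ : 𝓜(ℂ, B)) * ρ ξ) (x : G) (ξ η : Γ) :
    extendMul (c.act x) ((ρ ξ * ρ η * star (ρ (ξ * η)) : unitary 𝓜(ℂ, B)) : 𝓜(ℂ, B)) =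
      (k x ξ : 𝓜(ℂ, B)) * extendMul (adEquiv (ρ ξ)) (k x η) *
        ((ρ ξ * ρ η * star (ρ (ξ * η)) : unitary 𝓜(ℂ, B)) : 𝓜(ℂ, B)) *
        star (k x (ξ * η) : 𝓜(ℂ, B)) := by
  rw [extendMul_adEquiv]
  simp only [Submonoid.coe_mul, Unitary.coe_star, extendMul_mul, extendMul_star, h, star_mul,
    mul_assoc, unitary_star_mul_cancel]

/-- The third covariance identity, obtained by computing `c_x c_y (ρ_ξ)` in two ways. -/
theorem particular_tilde_act_cocycle
    (h : ∀ x ξ, extendMul (c.act x) (ρ ξ) = (k x ξ : 𝓜(ℂ, B)) * ρ ξ) (x y : G) (ξ : Γ) :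
    extendMul (adEquiv (ρ ξ)) (c.cocycle x y) =
      star (k x ξ : 𝓜(ℂ, B)) * extendMul (c.act x) (star (k y ξ : 𝓜(ℂ, B))) *
        c.cocycle x y * k (x * y) ξ := by
  have h1 := c.extendMul_act_act x y (ρ ξ : 𝓜(ℂ, B))
  rw [h, h, extendMul_mul, h] at h1
  have h2 : (ρ ξ : 𝓜(ℂ, B)) = star (k x ξ : 𝓜(ℂ, B)) *
      (extendMul (c.act x) (star (k y ξ : 𝓜(ℂ, B))) * ((c.cocycle x y : 𝓜(ℂ, B)) *
        ((k (x * y) ξ : 𝓜(ℂ, B)) * ρ ξ) * star (c.cocycle x y : 𝓜(ℂ, B)))) := by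
    rw [← h1, ← mul_assoc (extendMul _ _), ← extendMul_mul, unitary_star_mul, extendMul_one,
      one_mul, unitary_star_mul_cancel]
  rw [extendMul_adEquiv]
  nth_rewrite 1 [h2]
  simp only [mul_assoc, unitary_star_mul_cancel, unitary_mul_star, mul_one]

end Particular

/-! ### The action of the first group on `L¹` of the second -/

namespace CovariantStructure

variable {G : Type v} {Γ : Type w} {A : Type u}
  [Group G] [TopologicalSpace G] [MeasurableSpace G]
  [Group Γ] [TopologicalSpace Γ] [MeasurableSpace Γ]
  [NonUnitalCStarAlgebra A] {μ : Measure G} {ν : Measure Γ} (S : CovariantStructure G Γ A μ ν)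

/-- The operation `f ↦ (ζ ↦ a_x[f(ζ)] κ(x, ζ))` on functions. -/
def lift (x : G) (f : Γ → A) (ζ : Γ) : A :=
  (S.κ x ζ : 𝓜(ℂ, A)).snd (S.base.act x (f ζ))

/-- The inverse of `lift`. -/
def liftSymm (x : G) (f : Γ → A) (ζ : Γ) : A :=
  (S.base.act x).symm ((star (S.κ x ζ) : unitary 𝓜(ℂ, A)).1.snd (f ζ))

theorem coe_lift (x : G) (f : Γ → A) (ζ : Γ) : ((S.lift x f ζ : A) : 𝓜(ℂ, A)) =
    extendMul (S.base.act x) (f ζ : 𝓜(ℂ, A)) * (S.κ x ζ : 𝓜(ℂ, A)) := by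
  rw [lift, coe_snd_apply, coe_aut]

theorem lift_liftSymm (x : G) (f : Γ → A) : S.lift x (S.liftSymm x f) = f := by
  funext ζ
  refine coe_injective ?_
  rw [lift, liftSymm, StarAlgEquiv.apply_symm_apply, coe_snd_apply, coe_snd_apply,
    Unitary.coe_star, mul_assoc, unitary_star_mul, mul_one]

theorem liftSymm_lift (x : G) (f : Γ → A) : S.liftSymm x (S.lift x f) = f := by
  funext ζ
  refine coe_injective (extendMul_injective (S.base.act x) ?_)
  rw [← coe_aut, ← coe_aut, liftSymm, lift, StarAlgEquiv.apply_symm_apply, coe_snd_apply,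
    coe_snd_apply, Unitary.coe_star, mul_assoc, unitary_mul_star, mul_one]

theorem norm_lift (x : G) (f : Γ → A) (ζ : Γ) : ‖S.lift x f ζ‖ = ‖f ζ‖ := by
  rw [lift, norm_unitary_snd, norm_aut]

theorem extendMul_commutation (x : G) (ξ : Γ) (b : A) :
    extendMul (S.base.act x) (extendMul (S.tilde.act ξ) (b : 𝓜(ℂ, A))) =
      (S.κ x ξ : 𝓜(ℂ, A)) * extendMul (S.tilde.act ξ) (extendMul (S.base.act x) (b : 𝓜(ℂ, A))) *
        star (S.κ x ξ : 𝓜(ℂ, A)) := by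
  have h := congrArg (DoubleCentralizer.coe ℂ) (S.commutation x ξ b)
  rwa [coe_ad, coe_aut, coe_aut, coe_aut, coe_aut] at h

/-- Covariance of point masses: `c_x ((δ_ξ ⊗ 1) ⋄ f) = (δ_e ⊗ κ(x, ξ)) ⋄ (δ_ξ ⊗ 1) ⋄ c_x(f)`. -/
theorem lift_deltaLeft (x : G) (ξ : Γ) (f : Γ → A) :
    S.lift x (deltaLeft S.tilde ξ 1 f) = deltaLeft S.tilde ξ (S.κ x ξ) (S.lift x f) := by
  funext ζ
  refine coe_injective ?_
  have h := S.act_tilde_cocycle x ξ (ξ⁻¹ * ζ)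
  rw [mul_inv_cancel_left] at h
  rw [coe_lift, coe_deltaLeft, coe_deltaLeft, coe_lift, one_mul, extendMul_mul, h,
    S.extendMul_commutation, extendMul_mul]
  simp only [mul_assoc, unitary_star_mul, mul_one, unitary_star_mul_cancel]

/-- `c_x((δ_e ⊗ m) ⋄ f) = (δ_e ⊗ a_x(m)) ⋄ c_x(f)`. -/
theorem lift_deltaLeft_one (x : G) (m : 𝓜(ℂ, A)) (f : Γ → A) :
    S.lift x (deltaLeft S.tilde 1 m f) =
      deltaLeft S.tilde 1 (extendMul (S.base.act x) m) (S.lift x f) := by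
  funext ζ
  refine coe_injective ?_
  rw [coe_lift, deltaLeft_one_apply, deltaLeft_one_apply, coe_fst_apply, coe_fst_apply, coe_lift,
    extendMul_mul, mul_assoc]

theorem lift_one (f : Γ → A) : S.lift 1 f = f := by
  funext ζ
  rw [lift, S.κ_one_left, S.base.act_one]
  rfl

theorem lift_conv (x : G) (f g : Γ → A) :
    S.lift x (conv S.tilde ν f g) = conv S.tilde ν (S.lift x f) (S.lift x g) := by
  funext ζ
  let L : A →L[ℂ] A := (S.κ x ζ : 𝓜(ℂ, A)).snd.comp (autCLM (S.base.act x))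
  have hL : Isometry L := AddMonoidHomClass.isometry_of_norm L fun b => by
    change ‖(S.κ x ζ : 𝓜(ℂ, A)).snd (S.base.act x b)‖ = ‖b‖
    rw [norm_unitary_snd, norm_aut]
  change L (∫ _, _ ∂ν) = ∫ _, _ ∂ν
  refine (L.integral_comp_comm' hL.antilipschitz _).symm.trans ?_
  refine integral_congr_ae (Filter.Eventually.of_forall fun η => coe_injective ?_)
  have h := S.act_tilde_cocycle x η (η⁻¹ * ζ)
  rw [mul_inv_cancel_left] at h
  change (((S.κ x ζ : 𝓜(ℂ, A)).snd (S.base.act x _) : A) : 𝓜(ℂ, A)) = _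
  rw [coe_snd_apply, coe_aut, coe_snd_apply, coe_snd_apply, coe_mul, coe_mul, coe_aut, coe_aut,
    coe_lift, coe_lift, extendMul_mul, extendMul_mul, extendMul_mul, h, S.extendMul_commutation]
  simp only [mul_assoc, unitary_star_mul_cancel, unitary_star_mul, mul_one]

section Locally

variable [IsTopologicalGroup Γ] [LocallyCompactSpace Γ]

/-- `c_x c_y (f) = (δ_e ⊗ α(x, y)) ⋄ c_{xy}(f) ⋄ (δ_e ⊗ α(x, y))⋆`, with the last factor moved to the
left-hand side. -/
theorem deltaRight_lift_lift (x y : G) (f : Γ → A) :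
    deltaRight S.tilde 1 (S.base.cocycle x y) (S.lift x (S.lift y f)) =
      deltaLeft S.tilde 1 (S.base.cocycle x y) (S.lift (x * y) f) := by
  funext ζ
  refine coe_injective ?_
  rw [deltaLeft_one_apply, coe_fst_apply, coe_deltaRight, inv_one, mul_one,
    S.tilde.cocycle_one_right, modular_one, Complex.ofReal_one, inv_one, one_smul, coe_lift,
    coe_lift, coe_lift, extendMul_mul, S.base.extendMul_act_act, S.tilde_act_cocycle,
    extendMul_star, OneMemClass.coe_one, mul_one]
  have h : extendMul (S.base.act x) (S.κ y ζ : 𝓜(ℂ, A)) *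
      star (extendMul (S.base.act x) (S.κ y ζ : 𝓜(ℂ, A))) = 1 := by
    rw [← extendMul_star, ← extendMul_mul, unitary_mul_star, extendMul_one]
  have h' : ∀ w, extendMul (S.base.act x) (S.κ y ζ : 𝓜(ℂ, A)) *
      (star (extendMul (S.base.act x) (S.κ y ζ : 𝓜(ℂ, A))) * w) = w := fun w => by
    rw [← mul_assoc, h, one_mul]
  simp only [mul_assoc, unitary_mul_star_cancel, unitary_star_mul_cancel, h']

theorem lift_invol (x : G) (f : Γ → A) :
    S.lift x (invol S.tilde f) = invol S.tilde (S.lift x f) := by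
  funext ζ
  refine coe_injective ?_
  have h := S.act_tilde_cocycle x ζ ζ⁻¹
  rw [mul_inv_cancel, S.κ_one_right, OneMemClass.coe_one, star_one, mul_one] at h
  have h2 := S.extendMul_commutation x ζ (star (f ζ⁻¹))
  rw [coe_star] at h2
  rw [coe_lift, coe_invol, coe_invol, coe_lift, extendMul_smul, extendMul_mul, extendMul_star,
    h, h2]
  simp only [star_mul, extendMul_mul, extendMul_star, smul_mul_assoc, mul_assoc,
    unitary_star_mul_cancel, unitary_star_mul, mul_one]

end Locally

section Measurable

variable [SecondCountableTopology Γ] [BorelSpace Γ]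

theorem strictMeasurable_κ (x : G) : StrictMeasurable (fun ζ => (S.κ x ζ : 𝓜(ℂ, A))) ν :=
  StrictContinuous.strictMeasurable fun b =>
    ⟨(S.κ_continuous b).1.comp (continuous_const.prodMk continuous_id),
      (S.κ_continuous b).2.comp (continuous_const.prodMk continuous_id)⟩

variable [IsTopologicalGroup Γ] [ν.IsHaarMeasure]

theorem isLOneOp_lift (x : G) : IsLOneOp ν (S.lift x) :=
  isLOneOp_of_translation 1
    (fun ζ => (S.κ x ζ : 𝓜(ℂ, A)).snd.comp (autCLM (S.base.act x)))
    (fun ζ b => by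
      change ‖(S.κ x ζ : 𝓜(ℂ, A)).snd (S.base.act x b)‖ = ‖b‖
      rw [norm_unitary_snd, norm_aut])
    (fun b => (S.strictMeasurable_κ x (S.base.act x b)).2)
    (fun f ζ => by rw [one_mul]; rfl)

theorem isLOneOp_liftSymm (x : G) : IsLOneOp ν (S.liftSymm x) :=
  isLOneOp_of_translation 1
    (fun ζ => (autCLM (S.base.act x).symm).comp (star (S.κ x ζ) : unitary 𝓜(ℂ, A)).1.snd)
    (fun ζ b => by
      change ‖(S.base.act x).symm ((star (S.κ x ζ) : unitary 𝓜(ℂ, A)).1.snd b)‖ = ‖b‖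
      rw [norm_aut, norm_unitary_snd])
    (fun b => (autCLM (S.base.act x).symm).continuous.comp_aestronglyMeasurable
      ((S.strictMeasurable_κ x).star b).2)
    (fun f ζ => by rw [one_mul]; rfl)

end Measurable

end CovariantStructure

/-! ### The twisted action on the crossed product -/

namespace CovariantStructure

variable {G : Type v} {Γ : Type w} {A : Type u}
  [Group G] [TopologicalSpace G] [MeasurableSpace G]
  [Group Γ] [TopologicalSpace Γ] [IsTopologicalGroup Γ] [LocallyCompactSpace Γ]
  [SecondCountableTopology Γ] [MeasurableSpace Γ] [BorelSpace Γ]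
  [NonUnitalCStarAlgebra A] [TopologicalSpace.SeparableSpace A]
  {μ : Measure G} {ν : Measure Γ} [ν.IsHaarMeasure] (S : CovariantStructure G Γ A μ ν)

theorem exists_automorphism_lift (x : G) :
    ∃ φ : CrossedProduct S.tilde ν ≃⋆ₐ[ℂ] CrossedProduct S.tilde ν,
      ∀ b f, Represents S.tilde ν b f → Represents S.tilde ν (φ b) (S.lift x f) :=
  exists_automorphism S.tilde_measurable (S.isLOneOp_lift x) (S.isLOneOp_liftSymm x)
    (S.lift_liftSymm x) (S.liftSymm_lift x) (S.lift_conv x) (S.lift_invol x)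

/-- `c_x(δ_e ⊗ m) = δ_e ⊗ a_x(m)`. -/
theorem extendMul_delta_one {φ : G → CrossedProduct S.tilde ν ≃⋆ₐ[ℂ] CrossedProduct S.tilde ν}
    (hφ : ∀ x b f, Represents S.tilde ν b f → Represents S.tilde ν (φ x b) (S.lift x f))
    {D : unitary 𝓜(ℂ, A) → unitary 𝓜(ℂ, CrossedProduct S.tilde ν)}
    (hD : ∀ m : unitary 𝓜(ℂ, A),
      IsDelta S.tilde ν 1 (m : 𝓜(ℂ, A)) (D m : 𝓜(ℂ, CrossedProduct S.tilde ν)))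
    (x : G) (m : unitary 𝓜(ℂ, A)) :
    extendMul (φ x) (D m) =
      (D (extendUnitary (S.base.act x) m) : 𝓜(ℂ, CrossedProduct S.tilde ν)) :=
  extendMul_eq_of_fst <| crossedProduct_eq_of_continuous S.tilde_measurable
    ((autCLM (φ x)).continuous.comp (D m : 𝓜(ℂ, CrossedProduct S.tilde ν)).fst.continuous)
    ((ContinuousLinearMap.continuous _).comp (autCLM (φ x)).continuous) fun b f hb => by
      refine (hφ x _ _ (hD m _ _ hb).1).unique ?_
      rw [lift_deltaLeft_one]
      exact (hD (extendUnitary (S.base.act x) m) _ _ (hφ x b f hb)).1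

theorem lift_act_act {φ : G → CrossedProduct S.tilde ν ≃⋆ₐ[ℂ] CrossedProduct S.tilde ν}
    (hφ : ∀ x b f, Represents S.tilde ν b f → Represents S.tilde ν (φ x b) (S.lift x f))
    {D : unitary 𝓜(ℂ, A) → unitary 𝓜(ℂ, CrossedProduct S.tilde ν)}
    (hD : ∀ m : unitary 𝓜(ℂ, A),
      IsDelta S.tilde ν 1 (m : 𝓜(ℂ, A)) (D m : 𝓜(ℂ, CrossedProduct S.tilde ν)))
    (x y : G) (b : CrossedProduct S.tilde ν) :
    φ x (φ y b) = ad (D (S.base.cocycle x y)) (φ (x * y) b) := by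
  have h : (D (S.base.cocycle x y) : 𝓜(ℂ, CrossedProduct S.tilde ν)).snd (φ x (φ y b)) =
      (D (S.base.cocycle x y) : 𝓜(ℂ, CrossedProduct S.tilde ν)).fst (φ (x * y) b) := by
    refine crossedProduct_eq_of_continuous S.tilde_measurable
      ((ContinuousLinearMap.continuous _).comp
        ((autCLM (φ x)).continuous.comp (autCLM (φ y)).continuous))
      ((ContinuousLinearMap.continuous _).comp (autCLM (φ (x * y))).continuous) (fun b f hb => ?_) b
    refine (hD _ _ _ (hφ x _ _ (hφ y b f hb))).2.unique ?_
    rw [deltaRight_lift_lift]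
    exact (hD _ _ _ (hφ (x * y) b f hb)).1
  refine coe_injective ?_
  have h2 := congrArg (DoubleCentralizer.coe ℂ) h
  rw [coe_snd_apply, coe_fst_apply] at h2
  rw [coe_ad, ← h2, mul_assoc, unitary_mul_star, mul_one]

/-- The covariance condition `c_x(δ_ξ ⊗ 1) = (δ_e ⊗ κ(x, ξ)) ⋄ (δ_ξ ⊗ 1)`. -/
theorem extendMul_delta_unit {φ : G → CrossedProduct S.tilde ν ≃⋆ₐ[ℂ] CrossedProduct S.tilde ν}
    (hφ : ∀ x b f, Represents S.tilde ν b f → Represents S.tilde ν (φ x b) (S.lift x f))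
    {D : unitary 𝓜(ℂ, A) → unitary 𝓜(ℂ, CrossedProduct S.tilde ν)}
    (hD : ∀ m : unitary 𝓜(ℂ, A),
      IsDelta S.tilde ν 1 (m : 𝓜(ℂ, A)) (D m : 𝓜(ℂ, CrossedProduct S.tilde ν)))
    {ρ : Γ → unitary 𝓜(ℂ, CrossedProduct S.tilde ν)}
    (hρ : ∀ ξ, IsDelta S.tilde ν ξ 1 (ρ ξ : 𝓜(ℂ, CrossedProduct S.tilde ν)))
    (x : G) (ξ : Γ) :
    extendMul (φ x) (ρ ξ) =
      (D (S.κ x ξ) : 𝓜(ℂ, CrossedProduct S.tilde ν)) * (ρ ξ : 𝓜(ℂ, CrossedProduct S.tilde ν)) :=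
  extendMul_eq_of_fst <| crossedProduct_eq_of_continuous S.tilde_measurable
    ((autCLM (φ x)).continuous.comp (ρ ξ : 𝓜(ℂ, CrossedProduct S.tilde ν)).fst.continuous)
    ((ContinuousLinearMap.continuous _).comp (autCLM (φ x)).continuous) fun b f hb => by
      refine (hφ x _ _ (hρ ξ _ _ hb).1).unique ?_
      have h := (hD (S.κ x ξ) _ _ (hρ ξ _ _ (hφ x b f hb)).1).1
      rwa [deltaLeft_one_deltaLeft, mul_one, ← lift_deltaLeft] at h

theorem aestronglyMeasurable_lift [SecondCountableTopology G] [BorelSpace G]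
    {φ : G → CrossedProduct S.tilde ν ≃⋆ₐ[ℂ] CrossedProduct S.tilde ν}
    (hφ : ∀ x b f, Represents S.tilde ν b f → Represents S.tilde ν (φ x b) (S.lift x f))
    (b : CrossedProduct S.tilde ν) : AEStronglyMeasurable (fun x => φ x b) μ := by
  refine crossedProduct_induction S.tilde_measurable
    (isClosed_setOf_aestronglyMeasurable fun x => autCLM (φ x)) (fun b f hb => ?_) b
  refine aestronglyMeasurable_of_represents (fun x => hφ x b f hb) ?_
  exact S.κ_continuous.strictMeasurable.snd_apply
    (aestronglyMeasurable_aut_apply (φ := fun p : G × Γ => S.base.act p.1)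
      (fun b => (S.base_measurable.1 b).comp_fst) hb.1.aestronglyMeasurable.comp_snd)

theorem continuous_lift [FirstCountableTopology G] (hS : S.base.IsContinuous)
    {φ : G → CrossedProduct S.tilde ν ≃⋆ₐ[ℂ] CrossedProduct S.tilde ν}
    (hφ : ∀ x b f, Represents S.tilde ν b f → Represents S.tilde ν (φ x b) (S.lift x f))
    (b : CrossedProduct S.tilde ν) : Continuous (fun x => φ x b) := by
  refine crossedProduct_induction S.tilde_measurable
    (isClosed_setOf_continuous (Φ := fun x => autCLM (φ x)) fun x => norm_aut (φ x))
    (fun b f hb => ?_) b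
  refine continuous_of_represents (fun x => hφ x b f hb) hb.1.norm
    (fun x ζ => (S.norm_lift x f ζ).le) fun ζ => ?_
  have h1 : Continuous fun x : G => (x, ζ) := by fun_prop
  exact StrictContinuous.snd_apply (U := fun x => S.κ x ζ)
    (fun b => ⟨(S.κ_continuous b).1.comp h1, (S.κ_continuous b).2.comp h1⟩) (hS.1 (f ζ))

end CovariantStructure

end CovStr

end

open CovStr in
theorem theorem4p3 {G : Type v} {Γ : Type w} {A : Type u}
    [Group G] [TopologicalSpace G] [IsTopologicalGroup G] [LocallyCompactSpace G]
    [SecondCountableTopology G] [T2Space G] [MeasurableSpace G] [BorelSpace G]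
    [Group Γ] [TopologicalSpace Γ] [IsTopologicalGroup Γ] [LocallyCompactSpace Γ]
    [SecondCountableTopology Γ] [T2Space Γ] [MeasurableSpace Γ] [BorelSpace Γ]
    [NonUnitalCStarAlgebra A]
    (μ : Measure G) [μ.IsHaarMeasure] (ν : Measure Γ) [ν.IsHaarMeasure]
    (S : CovariantStructure G Γ A μ ν) :
    ∃ (T : CovariantStructure G Γ (CrossedProduct S.tilde ν) μ ν)
      (ρ : Γ → unitary 𝓜(ℂ, CrossedProduct S.tilde ν)),
      (∀ x ξ, IsDelta S.tilde ν 1 (S.κ x ξ) (T.κ x ξ)) ∧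
      (∀ x f b, Represents S.tilde ν b f →
        Represents S.tilde ν (T.base.act x b)
          (fun ζ => (S.κ x ζ : 𝓜(ℂ, A)).snd (S.base.act x (f ζ)))) ∧
      (∀ x y, IsDelta S.tilde ν 1 (S.base.cocycle x y) (T.base.cocycle x y)) ∧
      (∀ ξ, IsDelta S.tilde ν ξ 1 (ρ ξ)) ∧
      T.IsTildeParticular ρ ∧
      (∀ ξ η, IsDelta S.tilde ν 1 (S.tilde.cocycle ξ η) (T.tilde.cocycle ξ η)) ∧
      (S.IsContinuous →
        T.IsContinuous ∧
          StrictContinuous (fun ξ => (ρ ξ : 𝓜(ℂ, CrossedProduct S.tilde ν)))) := by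
  have := S.separable
  have ha := S.tilde_measurable
  choose φ hφ using S.exists_automorphism_lift
  choose D hD using fun m : unitary 𝓜(ℂ, A) => exists_isDelta ha 1 m
  have hρ' : ∀ ξ, ∃ U : unitary 𝓜(ℂ, CrossedProduct S.tilde ν), IsDelta S.tilde ν ξ 1 U.1 :=
    fun ξ => exists_isDelta ha ξ 1
  choose ρ hρ using hρ'
  have hD1 : D 1 = 1 := Subtype.ext ((hD 1).eq_one ha)
  have hDmul : ∀ m n, D m * D n = D (m * n) := fun m n =>
    Subtype.ext ((hD m).mul_eq ha (hD n) (hD (m * n)))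
  have hρ1 : ρ 1 = 1 := Subtype.ext ((hρ 1).eq_one ha)
  have hρcoc : ∀ ξ η, ρ ξ * ρ η * star (ρ (ξ * η)) = D (S.tilde.cocycle ξ η) := fun ξ η => by
    have h : ρ ξ * ρ η = D (S.tilde.cocycle ξ η) * ρ (ξ * η) :=
      Subtype.ext ((hρ ξ).mul_eq_mul ha (hρ η) (hD _) (hρ (ξ * η)))
    rw [h, mul_assoc, Unitary.mul_star_self, mul_one]
  let c : TwistedAction G (CrossedProduct S.tilde ν) :=
    { act := φ
      cocycle := fun x y => D (S.base.cocycle x y)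
      act_one := crossedProduct_eq_of_continuous ha (autCLM (φ 1)).continuous continuous_id
        fun b f hb => (hφ 1 b f hb).unique (by rwa [S.lift_one])
      act_act := S.lift_act_act hφ hD
      cocycle_one_right := fun x => by rw [S.base.cocycle_one_right, hD1]
      cocycle_one_left := fun x => by rw [S.base.cocycle_one_left, hD1]
      cocycle_mul := fun x y z => by
        rw [S.extendMul_delta_one hφ hD, ← Submonoid.coe_mul, ← Submonoid.coe_mul, hDmul, hDmul]
        congr 2
        exact Subtype.ext (S.base.cocycle_mul x y z) }
  have hcov : ∀ x ξ, extendMul (c.act x) (ρ ξ) =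
      (D (S.κ x ξ) : 𝓜(ℂ, CrossedProduct S.tilde ν)) * (ρ ξ : 𝓜(ℂ, CrossedProduct S.tilde ν)) :=
    S.extendMul_delta_unit hφ hD hρ
  have hρm := strictMeasurable_of_isDelta_unit ha hρ
  have htilde : ∀ p : Γ × Γ, IsDelta S.tilde ν 1 (S.tilde.cocycle p.1 p.2)
      ((innerTwistedAction ρ hρ1).cocycle p.1 p.2 : 𝓜(ℂ, CrossedProduct S.tilde ν)) := fun p => by
    rw [show (innerTwistedAction ρ hρ1).cocycle p.1 p.2 = D (S.tilde.cocycle p.1 p.2) from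
      hρcoc _ _]
    exact hD _
  let T : CovariantStructure G Γ (CrossedProduct S.tilde ν) μ ν :=
    { separable := separableSpace_crossedProduct ha
      base := c
      tilde := innerTwistedAction ρ hρ1
      base_measurable := ⟨S.aestronglyMeasurable_lift hφ,
        strictMeasurable_of_isDelta_one ha S.base_measurable.2 fun p => hD _⟩
      tilde_measurable := ⟨fun b => hρm.fst_apply (hρm.star b).2,
        strictMeasurable_of_isDelta_one ha S.tilde_measurable.2 htilde⟩
      κ := fun x ξ => D (S.κ x ξ)
      κ_continuous := strictContinuous_of_isDelta_one ha S.κ_continuous fun p => hD _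
      κ_one_left := fun ξ => by rw [S.κ_one_left, hD1]
      κ_one_right := fun x => by rw [S.κ_one_right, hD1]
      commutation := particular_commutation hcov
      act_tilde_cocycle := particular_act_tilde_cocycle hcov
      tilde_act_cocycle := particular_tilde_act_cocycle hcov }
  refine ⟨T, ρ, fun x ξ => hD _, fun x f b hb => hφ x b f hb, fun x y => hD _, hρ,
    ⟨hρ1, hρm, fun ξ b => rfl, fun ξ η => rfl, hcov⟩, fun ξ η => htilde (ξ, η), fun hS => ?_⟩
  have hρc := strictContinuous_of_isDelta_unit ha hS.2 hρ
  exact ⟨⟨⟨S.continuous_lift hS.1 hφ, strictContinuous_of_isDelta_one ha hS.1.2 fun p => hD _⟩,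
    ⟨fun b => hρc.fst_apply (hρc.star b).2,
      strictContinuous_of_isDelta_one ha hS.2.2 htilde⟩⟩, hρc⟩
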